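/- Let $G$ be a separable metrisable topological group. For compatible left-invariant metrics on $G$ write $\partial\lesssim d$ if $\partial\le K d+K$ for some constant $K$; such a metric is \emph{maximal} if it is maximal for this preorder. Maximal metrics, if they exist, are unique up to quasi-isometry. A map $F$ from $G$ to a metric space $(Y,d_Y)$ is called a quasi-isometry if $G$ admits a maximal compatible left-invariant metric and, for every such metric $d$, there are constants $K>0$, $C$ with $\frac1K d(g,h)-C\le d_Y(F(g),F(h))\le K d(g,h)+C$ for all $g,h\in G$ and every point of $Y$ within distance $C$ of $F[G]$. Automorphism and isometry groups of countable structures carry the permutation group topology, in which the cosets of the pointwise stabilisers of finite sets form a basis. (1) Let $\mathbf T$ be the $\aleph_0$-regular tree, i.e. a countable tree in which every vertex has infinite valence, with its path metric. For every vertex $t$, the map $\mathrm{Aut}(\mathbf T)\to\mathbf T$, $g\mapsto g(t)$, is a quasi-isometry. (2) Let $\mathfrak e$ be an end of $\mathbf T$, i.e. an equivalence class of infinite (injective) paths under the relation $(v_n)\sim(w_n)\Leftrightarrow\exists k,l\ \forall n\ v_{k+n}=w_{l+n}$, and let $\mathrm{Aut}(\mathbf T,\mathfrak e)$ be the group of automorphisms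 of $\mathbf T$ fixing $\mathfrak e$. For every vertex $t$, the map $\mathrm{Aut}(\mathbf T,\mathfrak e)\to\mathbf T$, $g\mapsto g(t)$, is a quasi-isometry. Consequently $\mathrm{Aut}(\mathbf T,\mathfrak e)$ is also quasi-isometric to $\mathrm{Aut}(\mathbf T)$ (with any maximal metric). (3) Let $\mathcal S$ be a countable additive subsemigroup of the positive reals and let $\mathcal S\mathbb U$ be the Fraïssé limit of the class of finite metric spaces with nonzero distances in $\mathcal S$, i.e. the countable metric space, unique up to isometry, whose finite subspaces are, up to isometry, exactly the finite metric spaces with nonzero distances in $\mathcal S$ and in which every isometry between finite subspaces extends to an isometry of the whole space onto itself. For every $x_0\in\mathcal S\mathbb U$, the map $\mathrm{Isom}(\mathcal S\mathbb U)\to\mathcal S\mathbb U$, $g\mapsto g(x_0)$, is a quasi-isometry. In particular, for $\mathcal S=\mathbb Q_+$, $\mathrm{Isom}(\mathbb Q\mathbb U)$ is quasi-isometric to $\mathbb Q\mathbb U$. -/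

import Mathlib

namespace LargeScale

/-- The map `F : X → Y` is a quasi-isometry with respect to the distance functions `dX`, `dY`. -/
def IsQuasiIsometry {X Y : Type*} (dX : X → X → ℝ) (dY : Y → Y → ℝ) (F : X → Y) : Prop :=
  ∃ K C : ℝ, 0 < K ∧
    (∀ x y, (1 / K) * dX x y - C ≤ dY (F x) (F y) ∧ dY (F x) (F y) ≤ K * dX x y + C) ∧
    ∀ y, ∃ x, dY (F x) y ≤ C

/-- `m` is a left-invariant metric on the group `G` which induces the topology `τ`. -/
structure IsCompatibleLeftInvariant {G : Type*} [Group G] (τ : TopologicalSpace G)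
    (m : MetricSpace G) : Prop where
  compatible : m.toUniformSpace.toTopologicalSpace = τ
  left_invariant : ∀ g x y : G, m.dist (g * x) (g * y) = m.dist x y

/-- The ordering `m₁ ≲ m₂` of metrics: `m₁ ≤ K * m₂ + K` for some constant `K`. -/
def CoarselyLE {G : Type*} (m₁ m₂ : MetricSpace G) : Prop :=
  ∃ K : ℝ, ∀ x y : G, m₁.dist x y ≤ K * m₂.dist x y + K

/-- `m` is maximal, with respect to `≲`, among the compatible left-invariant metrics. -/
def IsMaximalMetric {G : Type*} [Group G] (τ : TopologicalSpace G) (m : MetricSpace G) : Prop :=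
  IsCompatibleLeftInvariant τ m ∧
    ∀ m' : MetricSpace G, IsCompatibleLeftInvariant τ m' → CoarselyLE m m' → CoarselyLE m' m

/-- The topological group `(G, τ)` has a well-defined quasi-isometry type (there is a maximal
compatible left-invariant metric), and with respect to every maximal compatible left-invariant
metric on `G` the map `F : G → Y` is a quasi-isometry onto the space `Y` with distance `dY`. -/
def IsGroupQuasiIsometry {G Y : Type*} [Group G] (τ : TopologicalSpace G) (dY : Y → Y → ℝ)
    (F : G → Y) : Prop :=
  (∃ m : MetricSpace G, IsMaximalMetric τ m) ∧
    ∀ m : MetricSpace G, IsMaximalMetric τ m → IsQuasiIsometry m.dist dY F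

/-- The permutation group topology on a set `G` of self-maps of `X`: the cosets
`{h | ∀ x ∈ A, h x = g x}` of the pointwise stabilisers of finite sets `A ⊆ X` are a basis. -/
abbrev permTopology (G X : Type*) [FunLike G X X] : TopologicalSpace G where
  IsOpen U := ∀ g ∈ U, ∃ A : Finset X, ∀ h : G, (∀ x ∈ A, h x = g x) → h ∈ U
  isOpen_univ := fun _ _ => ⟨∅, fun _ _ => trivial⟩
  isOpen_inter := by
    classical
    intro U W hU hW g hg
    obtain ⟨A, hA⟩ := hU g hg.1
    obtain ⟨B, hB⟩ := hW g hg.2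
    exact ⟨A ∪ B, fun h hh => ⟨hA h fun x hx => hh x (Finset.mem_union_left _ hx),
      hB h fun x hx => hh x (Finset.mem_union_right _ hx)⟩⟩
  isOpen_sUnion := by
    intro 𝒰 h𝒰 g hg
    obtain ⟨U, hU, hgU⟩ := hg
    obtain ⟨A, hA⟩ := h𝒰 U hU g hgU
    exact ⟨A, fun h hh => ⟨U, hU, hA h hh⟩⟩

/-- `T` is the `ℵ₀`-regular tree: a countable tree in which every vertex has infinite valence. -/
structure IsAlephZeroRegularTree {V : Type*} (T : SimpleGraph V) : Prop where
  countable : Countable V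
  isTree : T.IsTree
  infinite_valence : ∀ v : V, (T.neighborSet v).Infinite

/-- The shortest path distance of a graph, as a real number. -/
noncomputable def graphDist {V : Type*} (T : SimpleGraph V) (v w : V) : ℝ := (T.dist v w : ℝ)

/-- An infinite path `(v₀, v₁, v₂, …)` in a graph. -/
structure InfinitePath {V : Type*} (T : SimpleGraph V) where
  toFun : ℕ → V
  injective : Function.Injective toFun
  adj : ∀ n, T.Adj (toFun n) (toFun (n + 1))

/-- Two infinite paths are equivalent if they agree after deleting initial segments. -/
def pathSetoid {V : Type*} (T : SimpleGraph V) : Setoid (InfinitePath T) where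
  r v w := ∃ k l : ℕ, ∀ n : ℕ, v.toFun (k + n) = w.toFun (l + n)
  iseqv :=
    { refl := fun _ => ⟨0, 0, fun _ => rfl⟩
      symm := fun ⟨k, l, h⟩ => ⟨l, k, fun n => (h n).symm⟩
      trans := by
        rintro u v w ⟨k, l, h⟩ ⟨p, q, h'⟩
        refine ⟨k + p, q + l, fun n => ?_⟩
        rw [add_assoc, h, add_assoc, ← h']
        congr 1
        omega }

/-- The ends of a tree: equivalence classes of infinite paths. -/
abbrev TreeEnd {V : Type*} (T : SimpleGraph V) : Type _ := Quotient (pathSetoid T)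

/-- The image of an infinite path under an automorphism. -/
def InfinitePath.map {V : Type*} {T : SimpleGraph V} (g : T ≃g T) (v : InfinitePath T) :
    InfinitePath T where
  toFun n := g (v.toFun n)
  injective := g.injective.comp v.injective
  adj n := g.map_adj_iff.2 (v.adj n)

/-- Automorphisms of a tree act on its ends. -/
instance treeEndAction {V : Type*} (T : SimpleGraph V) : MulAction (T ≃g T) (TreeEnd T) where
  smul g := Quotient.map (InfinitePath.map g)
    (fun _ _ ⟨k, l, h⟩ => ⟨k, l, fun n => congrArg g (h n)⟩)
  one_smul := by rintro ⟨v⟩; rfl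
  mul_smul := by rintro g h ⟨v⟩; rfl

/-- The group of automorphisms of `T` fixing the end `e`. -/
def endStabilizer {V : Type*} (T : SimpleGraph V) (e : TreeEnd T) : Subgroup (T ≃g T) :=
  MulAction.stabilizer (T ≃g T) e

/-- The permutation group topology on the group of automorphisms fixing an end. -/
abbrev endStabilizerTopology {V : Type*} (T : SimpleGraph V) (e : TreeEnd T) :
    TopologicalSpace (endStabilizer T e) :=
  TopologicalSpace.induced (fun g => (g : T ≃g T)) (permTopology (T ≃g T) V)

/-- `X` is the Urysohn space with distances in `S`, i.e. the Fraïssé limit of the class of finite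
metric spaces with (nonzero) distances in `S`: `X` is countable, the finite metric spaces embedding
isometrically into `X` are exactly those with distances in `S`, and `X` is ultrahomogeneous. -/
structure IsUrysohnSpace (S : Set ℝ) (X : Type*) [MetricSpace X] : Prop where
  countable : Countable X
  dist_mem : ∀ x y : X, x ≠ y → dist x y ∈ S
  universal : ∀ (n : ℕ) (m : MetricSpace (Fin n)), (∀ i j : Fin n, i ≠ j → m.dist i j ∈ S) →
    ∃ f : Fin n → X, ∀ i j : Fin n, dist (f i) (f j) = m.dist i j
  ultrahomogeneous : ∀ (A : Finset X) (f : A → X), Isometry f →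
    ∃ g : X ≃ᵢ X, ∀ a : A, g a = f a

end LargeScale

/-!
The theorem follows from one principle. Let `G` act on `X` by permutations, with the permutation
group topology, and let `dX` be an invariant distance on `X`. If `G` is transitive and every length
function on `G` (a metric `m` gives the length function `g ↦ m (1, g)`) is bounded by an affine
function of the displacement `dX x₀ (g x₀)`, then `dX (g x₀, h x₀)`, made into a metric by adding a
bounded compatible one, is the largest compatible left-invariant metric on `G` up to `≲`, so that
`g ↦ g x₀` is a quasi-isometry (`OrbitControlsLengths.isGroupQuasiIsometry`).

The bound on length functions has two ingredients. First, length functions are bounded on the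
stabiliser of a point `t` (`IsLength.bddOn_stabilizer`): a length function `L` is at most `1` on the
pointwise stabiliser of a finite set `A`, and if `g t = t`, there is a translate `h A` which is
independent, over `t`, of both `A` and `g A`; by homogeneity some element that agrees with `g` on
`A` fixes `h A` pointwise, and `h` itself can be taken from a single double coset of the stabiliser
of `A`. Secondly, every element is a product of elements of the stabiliser and of finitely many
fixed further elements, with a number of factors that is bounded linearly in the displacement.

For both tree groups this is carried out for trees whose oriented edges are coloured such that all
vertices look alike (`IsHomogeneousColoring`). Isomorphisms between finite subtrees extend by back
and forth (`IsPartialIso.exists_perm`), and two finite subtrees containing `t` are independent if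
they only meet in `t`. One colour gives `Aut(T)`; for the stabiliser of an end an edge is coloured
according to whether it points towards the end. In the latter case there is only one edge towards
the end at each vertex, so a finite subtree can be made independent only over its vertex closest to
the end; this is why the point `t` depends on `A`. The stabiliser of the end is then included
quasi-isometrically in `Aut(T)`, since both orbit maps to `T` are quasi-isometries.

In the Urysohn space homogeneity is part of the definition, `A` and `B` are independent over `t` if
all distances between them are realised through `t` (the free amalgam, which has distances in `S` as
`S` is closed under addition), and the linear bound comes from triangles with sides in `S`: a
displacement `n s` is split into `n` steps of size `s`, and an arbitrary displacement `r ≤ 2 n s`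
into two of size `n s`.
-/

open scoped Topology

namespace LargeScale

/-! ### Length functions and quasi-isometric orbit maps -/

section Orbit

variable {G X : Type*} [Group G]

/-- A length function on a group `G` acting on a set `X` through `φ`, continuous for the permutation
group topology in the weak sense that it is at most `1` on the pointwise stabiliser of some finite
set. Every compatible left-invariant metric `m` gives such a function `g ↦ m (1, g)`. -/
structure IsLength (φ : G →* Equiv.Perm X) (L : G → ℝ) : Prop where
  one : L 1 = 0
  inv : ∀ g, L g⁻¹ = L g
  mul_le : ∀ g h, L (g * h) ≤ L g + L h
  small : ∃ A : Finset X, ∀ g, (∀ x ∈ A, φ g x = x) → L g ≤ 1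

/-- Every length function is bounded by an affine function of the displacement of `x₀`, measured by
`dX`. -/
def OrbitControlsLengths (φ : G →* Equiv.Perm X) (dX : X → X → ℝ) (x₀ : X) : Prop :=
  ∀ L : G → ℝ, IsLength φ L → ∃ K, ∀ g, L g ≤ K * dX x₀ (φ g x₀) + K

/-- `τ` is the permutation group topology of the action `φ` of `G` on `X`. -/
def IsPermTopology (φ : G →* Equiv.Perm X) (τ : TopologicalSpace G) : Prop :=
  ∀ U : Set G, IsOpen[τ] U ↔
    ∀ g ∈ U, ∃ A : Finset X, ∀ h, (∀ x ∈ A, φ h x = φ g x) → h ∈ U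

/-- A distance function on `X` that satisfies the axioms of a pseudometric and is invariant under
the action `φ`. -/
structure IsInvariantDist (φ : G →* Equiv.Perm X) (dX : X → X → ℝ) : Prop where
  self : ∀ x, dX x x = 0
  comm : ∀ x y, dX x y = dX y x
  triangle : ∀ x y z, dX x z ≤ dX x y + dX y z
  map : ∀ g x y, dX (φ g x) (φ g y) = dX x y

lemma apply_apply_inv (φ : G →* Equiv.Perm X) (g : G) (x : X) : φ g (φ g⁻¹ x) = x := by
  rw [← Equiv.Perm.mul_apply, ← map_mul, mul_inv_cancel, map_one, Equiv.Perm.one_apply]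

lemma IsInvariantDist.nonneg {φ : G →* Equiv.Perm X} {dX : X → X → ℝ} (h : IsInvariantDist φ dX)
    (x y : X) : 0 ≤ dX x y := by
  have h1 := h.triangle x y x
  rw [h.self, h.comm y x] at h1
  linarith

lemma IsLength.nonneg {φ : G →* Equiv.Perm X} {L : G → ℝ} (h : IsLength φ L) (g : G) :
    0 ≤ L g := by
  have h1 := h.mul_le g g⁻¹
  rw [mul_inv_cancel, h.one, h.inv] at h1
  linarith

/-- A left-invariant compatible metric gives a length function. -/
lemma IsCompatibleLeftInvariant.isLength {φ : G →* Equiv.Perm X} {τ : TopologicalSpace G}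
    (hτ : IsPermTopology φ τ) {m : MetricSpace G} (hm : IsCompatibleLeftInvariant τ m) :
    IsLength φ (fun g => m.dist 1 g) where
  one := dist_self _
  inv g := by
    have h := hm.left_invariant g 1 g⁻¹
    rw [mul_one, mul_inv_cancel] at h
    change m.dist 1 g⁻¹ = m.dist 1 g
    rw [← h]
    exact dist_comm _ _
  mul_le g h := by
    have h1 := hm.left_invariant g 1 h
    rw [mul_one] at h1
    change m.dist 1 (g * h) ≤ m.dist 1 g + m.dist 1 h
    rw [← h1]
    exact dist_triangle _ _ _
  small := by
    have ho : IsOpen[τ] (Metric.ball (1 : G) 1) := by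
      rw [← hm.compatible]
      exact Metric.isOpen_ball
    obtain ⟨A, hA⟩ := (hτ _).1 ho 1 (Metric.mem_ball_self one_pos)
    refine ⟨A, fun g hg => ?_⟩
    have h1 := hA g (by simpa using hg)
    rw [Metric.mem_ball'] at h1
    exact h1.le

lemma IsCompatibleLeftInvariant.dist_eq {τ : TopologicalSpace G} {m : MetricSpace G}
    (hm : IsCompatibleLeftInvariant τ m) (g h : G) : m.dist g h = m.dist 1 (g⁻¹ * h) := by
  rw [← hm.left_invariant g 1, mul_one, mul_inv_cancel_left]

/-- If the orbit of `x₀` controls lengths, every compatible left-invariant metric is bounded by an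
affine function of the distance of the orbit points. -/
lemma OrbitControlsLengths.dist_le {φ : G →* Equiv.Perm X} {dX : X → X → ℝ} {x₀ : X}
    (hc : OrbitControlsLengths φ dX x₀) (hd : IsInvariantDist φ dX) {τ : TopologicalSpace G}
    (hτ : IsPermTopology φ τ) {m : MetricSpace G} (hm : IsCompatibleLeftInvariant τ m) :
    ∃ K, 0 < K ∧ ∀ g h, m.dist g h ≤ K * dX (φ g x₀) (φ h x₀) + K := by
  obtain ⟨K, hK⟩ := hc _ (hm.isLength hτ)
  refine ⟨max K 1, by positivity, fun g h => ?_⟩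
  have h1 := hK (g⁻¹ * h)
  rw [← hm.dist_eq, ← hd.map g, map_mul, Equiv.Perm.mul_apply, ← Equiv.Perm.mul_apply (φ g),
    ← map_mul, mul_inv_cancel, map_one, Equiv.Perm.one_apply] at h1
  have h2 := hd.nonneg (φ g x₀) (φ h x₀)
  have h3 := le_max_left K 1
  nlinarith

lemma firstDiff_comp_injective {α β : Type*} {f : α → β} (hf : Function.Injective f) (x y : ℕ → α) :
    PiNat.firstDiff (E := fun _ => β) (fun n => f (x n)) (fun n => f (y n)) =
      PiNat.firstDiff (E := fun _ => α) x y := by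
  classical
  by_cases hxy : x = y
  · subst hxy
    simp [PiNat.firstDiff_def]
  · have h2 : (fun n => f (x n)) ≠ (fun n => f (y n)) := fun h =>
      hxy (funext fun n => hf (congrFun h n))
    rw [PiNat.firstDiff_def, PiNat.firstDiff_def, dif_pos hxy, dif_pos h2]
    simp only [ne_eq, hf.eq_iff]

/-- The group carries a compatible left-invariant metric for which the orbit map at `x₀` is
`1`-Lipschitz: the sum of the displacement of `x₀` and of the bounded metric of pointwise
convergence along an enumeration of `X`. -/
lemma exists_isCompatibleLeftInvariant_ge [Countable X] {φ : G →* Equiv.Perm X}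
    (hφ : Function.Injective φ) {τ : TopologicalSpace G} (hτ : IsPermTopology φ τ)
    {dX : X → X → ℝ} (hd : IsInvariantDist φ dX) (x₀ : X) :
    ∃ m : MetricSpace G, IsCompatibleLeftInvariant τ m ∧
      ∀ g h, dX (φ g x₀) (φ h x₀) ≤ m.dist g h := by
  classical
  have : Nonempty X := ⟨x₀⟩
  obtain ⟨e, he⟩ := exists_surjective_nat X
  let s : G → ℕ → X := fun g n => φ g (e n)
  have hs : Function.Injective s := fun g h hgh => hφ <| by
    ext x
    obtain ⟨n, rfl⟩ := he x
    exact congrFun hgh n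
  let D : G → G → ℝ := fun g h => (PiNat.dist (E := fun _ => X)).dist (s g) (s h)
  have hD0 : ∀ g h, 0 ≤ D g h := fun g h => PiNat.dist_nonneg _ _
  let m : MetricSpace G :=
    { dist := fun g h => dX (φ g x₀) (φ h x₀) + D g h
      dist_self := fun g => by simp only [hd.self, D, PiNat.dist_self, add_zero]
      dist_comm := fun g h => by simp only [hd.comm (φ g x₀), D, PiNat.dist_comm (s g)]
      dist_triangle := fun g h k => by
        have h1 := hd.triangle (φ g x₀) (φ h x₀) (φ k x₀)
        have h2 := PiNat.dist_triangle (s g) (s h) (s k)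
        simp only [D]
        linarith
      eq_of_dist_eq_zero := fun {g h} hgh => hs <| by
        have h1 := hd.nonneg (φ g x₀) (φ h x₀)
        have h2 := hD0 g h
        have hgh' : dX (φ g x₀) (φ h x₀) + D g h = 0 := hgh
        exact PiNat.eq_of_dist_eq_zero _ _ (by simp only [D] at *; linarith) }
  have hm : ∀ g h, m.dist g h = dX (φ g x₀) (φ h x₀) + D g h := fun _ _ => rfl
  refine ⟨m, ⟨?_, fun g x y => ?_⟩, fun g h => ?_⟩
  · refine TopologicalSpace.ext_iff.2 fun U => ?_
    rw [hτ]
    refine (@Metric.isOpen_iff G m.toPseudoMetricSpace U).trans ?_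
    refine forall₂_congr fun g _ => ⟨?_, ?_⟩
    · rintro ⟨ε, hε, hU⟩
      obtain ⟨n, hn⟩ := exists_pow_lt_of_lt_one hε (by norm_num : (1 / 2 : ℝ) < 1)
      refine ⟨insert x₀ ((Finset.range n).image e), fun h hh => hU ?_⟩
      rw [Metric.mem_ball]
      have h0 : φ h x₀ = φ g x₀ := hh _ (Finset.mem_insert_self _ _)
      rw [hm, h0, hd.self, zero_add]
      refine lt_of_le_of_lt ?_ hn
      have := @PiNat.mem_cylinder_iff_dist_le (fun _ => X) (s g) (s h) n
      refine this.1 fun i hi => ?_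
      exact hh _ (Finset.mem_insert_of_mem (Finset.mem_image_of_mem _ (Finset.mem_range.2 hi)))
    · rintro ⟨A, hA⟩
      choose i hi using he
      refine ⟨(1 / 2) ^ (A.sup i), by positivity, fun h hh => hA h fun x hx => ?_⟩
      rw [Metric.mem_ball] at hh
      have hh' : m.dist h g < (1 / 2) ^ (A.sup i) := hh
      have h1 : D h g < (1 / 2) ^ (A.sup i) := by
        have := hd.nonneg (φ h x₀) (φ g x₀)
        rw [hm] at hh'
        linarith
      have h2 := PiNat.apply_eq_of_dist_lt (E := fun _ => X) h1 (Finset.le_sup hx)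
      simpa only [s, hi] using h2
  · rw [hm, hm, map_mul, map_mul, Equiv.Perm.mul_apply, Equiv.Perm.mul_apply, hd.map]
    congr 1
    by_cases hxy : x = y
    · subst hxy
      simp only [D, PiNat.dist_self]
    · simp only [D]
      rw [PiNat.dist_eq_of_ne (hs.ne hxy),
        PiNat.dist_eq_of_ne (hs.ne ((mul_right_injective g).ne hxy)),
        ← firstDiff_comp_injective (φ g).injective (s x) (s y)]
      simp only [s, map_mul, Equiv.Perm.mul_apply]
  · rw [hm]
    linarith [hD0 g h]

/-- If the orbit of `x₀` is everything and controls lengths, then the orbit map is a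
quasi-isometry. -/
theorem OrbitControlsLengths.isGroupQuasiIsometry [Countable X] {φ : G →* Equiv.Perm X}
    (hφ : Function.Injective φ) {τ : TopologicalSpace G} (hτ : IsPermTopology φ τ)
    {dX : X → X → ℝ} (hd : IsInvariantDist φ dX) {x₀ : X} (htrans : ∀ y, ∃ g, φ g x₀ = y)
    (hc : OrbitControlsLengths φ dX x₀) :
    IsGroupQuasiIsometry τ dX (fun g => φ g x₀) := by
  obtain ⟨m₀, hm₀, hle⟩ := exists_isCompatibleLeftInvariant_ge hφ hτ hd x₀
  -- `m₀` is even the largest compatible left-invariant metric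
  have hmax : ∀ m : MetricSpace G, IsCompatibleLeftInvariant τ m → CoarselyLE m m₀ := by
    intro m hm
    obtain ⟨K, hK0, hK⟩ := hc.dist_le hd hτ hm
    refine ⟨K, fun g h => (hK g h).trans ?_⟩
    have := hle g h
    gcongr
  refine ⟨⟨m₀, hm₀, fun m hm _ => hmax m hm⟩, fun m hm => ?_⟩
  obtain ⟨K, hK0, hK⟩ := hc.dist_le hd hτ hm.1
  obtain ⟨K', hK'⟩ := hm.2 m₀ hm₀ (hmax m hm.1)
  refine ⟨max K K', max 1 K', by positivity, fun g h => ⟨?_, ?_⟩, fun y => ?_⟩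
  · have h1 := hK g h
    have h2 : (m.dist g h - K) / K ≤ dX (φ g x₀) (φ h x₀) := by
      rw [div_le_iff₀ hK0]
      linarith
    have h3 : (1 / max K K') * m.dist g h ≤ (1 / K) * m.dist g h :=
      mul_le_mul_of_nonneg_right (one_div_le_one_div_of_le hK0 (le_max_left _ _)) dist_nonneg
    have h4 : (m.dist g h - K) / K = (1 / K) * m.dist g h - 1 := by field_simp
    linarith [le_max_left 1 K']
  · have h1 := hK' g h
    have h2 : K' * m.dist g h ≤ max K K' * m.dist g h :=
      mul_le_mul_of_nonneg_right (le_max_right _ _) dist_nonneg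
    linarith [le_max_right 1 K', hle g h]
  · obtain ⟨g, hg⟩ := htrans y
    refine ⟨g, ?_⟩
    simp only [hg, hd.self]
    positivity

/-- A map between the sources of two quasi-isometries to the same space that commutes with these is
a quasi-isometry. -/
lemma IsQuasiIsometry.of_comp {A B Y : Type*} {dA : A → A → ℝ} {dB : B → B → ℝ} {dY : Y → Y → ℝ}
    {F : A → Y} {F' : B → Y} {j : A → B} (hF : IsQuasiIsometry dA dY F)
    (hF' : IsQuasiIsometry dB dY F') (hj : ∀ a, F' (j a) = F a) : IsQuasiIsometry dA dB j := by
  obtain ⟨K, C, hK, h1, h2⟩ := hF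
  obtain ⟨K', C', hK', h1', -⟩ := hF'
  refine ⟨K * K', max (K' * (C + C')) (C / K' + C' / K'), by positivity, fun x y => ⟨?_, ?_⟩,
    fun b => ?_⟩
  · have ha := (h1 x y).1
    have hb := (h1' (j x) (j y)).2
    rw [hj, hj] at hb
    have hc : (1 / K * dA x y - C - C') / K' ≤ dB (j x) (j y) := by
      rw [div_le_iff₀ hK']
      linarith
    have hd : (1 / K * dA x y - C - C') / K' = 1 / (K * K') * dA x y - (C / K' + C' / K') := by
      field_simp
      ring
    linarith [le_max_right (K' * (C + C')) (C / K' + C' / K')]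
  · have ha := (h1 x y).2
    have hb := (h1' (j x) (j y)).1
    rw [hj, hj] at hb
    have hc : 1 / K' * dB (j x) (j y) ≤ K * dA x y + C + C' := by linarith
    rw [one_div, inv_mul_le_iff₀ hK'] at hc
    have hd : K' * (K * dA x y + C + C') = K * K' * dA x y + K' * (C + C') := by ring
    linarith [le_max_left (K' * (C + C')) (C / K' + C' / K')]
  · obtain ⟨a, ha⟩ := h2 (F' b)
    refine ⟨a, ?_⟩
    have hb := (h1' (j a) b).1
    rw [hj] at hb
    have hc : 1 / K' * dB (j a) b ≤ C + C' := by linarith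
    rw [one_div, inv_mul_le_iff₀ hK'] at hc
    exact hc.trans (le_max_left _ _)

/-- The condition `P h` says that the translate of `A` by `h` is independent of `A` over the base
point `t`. If independent translates of `A` are conjugate over `A`, and if every `g` fixing `t`
admits a translate of `A` independent of both `A` and `g A`, then length functions that are small on
the stabiliser of `A` are bounded on the stabiliser of `t`. -/
lemma IsLength.bddOn_stabilizer {φ : G →* Equiv.Perm X} {L : G → ℝ} (hL : IsLength φ L)
    {A : Finset X}
    (hA : ∀ g, (∀ x ∈ A, φ g x = x) → L g ≤ 1) {t : X} {P : G → Prop}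
    (hex : ∀ g, φ g t = t → ∃ h, P h ∧ P (g⁻¹ * h))
    (hconj : ∀ f h, P f → P h →
      ∃ v, (∀ a ∈ A, φ v a = a) ∧ ∀ a ∈ A, φ v (φ f a) = φ h a) :
    ∃ C, ∀ g, φ g t = t → L g ≤ C := by
  obtain ⟨f, hf, -⟩ := hex 1 (by simp)
  -- `P h` puts `h` into the double coset of `f` with respect to the stabiliser of `A`
  have hbound : ∀ h, P h → L h ≤ L f + 2 := by
    intro h hh
    obtain ⟨v, hv, hvf⟩ := hconj f h hf hh
    have h1 : L ((v * f)⁻¹ * h) ≤ 1 := hA _ fun a ha => by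
      rw [map_mul, map_inv, Equiv.Perm.mul_apply, Equiv.Perm.inv_eq_iff_eq, ← hvf a ha]
      simp
    have h2 := hL.mul_le (v * f) ((v * f)⁻¹ * h)
    rw [mul_inv_cancel_left] at h2
    linarith [hL.mul_le v f, hA v hv]
  refine ⟨2 * (L f + 2) + 2, fun g hg => ?_⟩
  obtain ⟨h, hh, hgh⟩ := hex g hg
  obtain ⟨v, hv, hvh⟩ := hconj _ _ hh hgh
  -- `g * v` fixes the translate of `A` by `h` pointwise
  have hk : L (h⁻¹ * (g * v) * h) ≤ 1 := hA _ fun a ha => by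
    have := hvh a ha
    simp only [map_mul, map_inv, Equiv.Perm.mul_apply] at this ⊢
    rw [this]
    simp
  have e1 : g = (h * (h⁻¹ * (g * v) * h) * h⁻¹) * v⁻¹ := by group
  rw [e1]
  have h2 := hL.mul_le (h * (h⁻¹ * (g * v) * h) * h⁻¹) v⁻¹
  have h3 := hL.mul_le (h * (h⁻¹ * (g * v) * h)) h⁻¹
  have h4 := hL.mul_le h (h⁻¹ * (g * v) * h)
  rw [hL.inv] at h2 h3
  linarith [hA v hv, hbound h hh]

end Orbit

/-! ### Back and forth -/

/-- Back and forth: in a countable set, a finite partial injection belonging to a family of finite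
partial injections that has the back-and-forth property extends to a permutation, any two values of
which are given by a member of the family. -/
lemma exists_perm_of_backAndForth {X : Type*} [Countable X] {I : Finset (X × X) → Prop}
    (hI : ∀ p, I p → ∀ u ∈ p, ∀ w ∈ p, u.1 = w.1 ↔ u.2 = w.2)
    (forth : ∀ p, I p → ∀ x, ∃ q, p ⊆ q ∧ I q ∧ ∃ w ∈ q, w.1 = x)
    (back : ∀ p, I p → ∀ x, ∃ q, p ⊆ q ∧ I q ∧ ∃ w ∈ q, w.2 = x)
    {p : Finset (X × X)} (hp : I p) :
    ∃ g : Equiv.Perm X, (∀ u ∈ p, g u.1 = u.2) ∧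
      ∀ x y, ∃ q, I q ∧ (x, g x) ∈ q ∧ (y, g y) ∈ q := by
  cases nonempty_encodable X
  let D : X ⊕ X → Order.Cofinal {p // I p} := Sum.elim
    (fun x => ⟨{q | ∃ w ∈ q.1, w.1 = x}, fun q => by
      obtain ⟨r, h1, h2, h3⟩ := forth q.1 q.2 x
      exact ⟨⟨r, h2⟩, h3, h1⟩⟩)
    (fun x => ⟨{q | ∃ w ∈ q.1, w.2 = x}, fun q => by
      obtain ⟨r, h1, h2, h3⟩ := back q.1 q.2 x
      exact ⟨⟨r, h2⟩, h3, h1⟩⟩)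
  let J := Order.idealOfCofinals ⟨p, hp⟩ D
  have hleft : ∀ x, ∃ y, ∃ q ∈ J, (x, y) ∈ q.1 := fun x => by
    obtain ⟨q, ⟨w, hw, hwx⟩, hq⟩ := Order.cofinal_meets_idealOfCofinals ⟨p, hp⟩ D (Sum.inl x)
    exact ⟨w.2, q, hq, by rwa [← hwx]⟩
  have hright : ∀ y, ∃ x, ∃ q ∈ J, (x, y) ∈ q.1 := fun y => by
    obtain ⟨q, ⟨w, hw, hwx⟩, hq⟩ := Order.cofinal_meets_idealOfCofinals ⟨p, hp⟩ D (Sum.inr y)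
    exact ⟨w.1, q, hq, by rwa [← hwx]⟩
  choose f qf hqf hf using hleft
  choose f' qf' hqf' hf' using hright
  have huniq : ∀ q ∈ J, ∀ r ∈ J, ∀ u ∈ q.1, ∀ w ∈ r.1, u.1 = w.1 ↔ u.2 = w.2 := by
    intro q hq r hr u hu w hw
    obtain ⟨s, -, hqs, hrs⟩ := J.directed q hq r hr
    exact hI s.1 s.2 u (hqs hu) w (hrs hw)
  let g : Equiv.Perm X :=
    { toFun := f
      invFun := f'
      left_inv := fun x => ((huniq _ (hqf' (f x)) _ (hqf x) _ (hf' (f x)) _ (hf x)).2 rfl)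
      right_inv := fun y => ((huniq _ (hqf (f' y)) _ (hqf' y) _ (hf (f' y)) _ (hf' y)).1 rfl) }
  refine ⟨g, fun u hu => ?_, fun x y => ?_⟩
  · exact (huniq _ (hqf u.1) _ (Order.mem_idealOfCofinals ⟨p, hp⟩ D) _ (hf u.1) _ hu).1 rfl
  · obtain ⟨s, -, hs, hs'⟩ := J.directed _ (hqf x) _ (hqf y)
    exact ⟨s.1, s.2, hs (hf x), hs' (hf y)⟩

/-! ### Geodesics in trees -/

section Tree

variable {V : Type*} {T : SimpleGraph V}

lemma exists_adj_dist_add_one (hT : T.IsTree) {a b : V} (hab : a ≠ b) :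
    ∃ z, T.Adj a z ∧ T.dist z b + 1 = T.dist a b := by
  obtain ⟨w, hw⟩ := hT.connected.exists_walk_length_eq_dist a b
  cases w with
  | nil => exact (hab rfl).elim
  | @cons _ z _ h w =>
    refine ⟨z, h, ?_⟩
    have h1 := T.dist_le w
    have h2 := hT.connected.dist_triangle (u := a) (v := z) (w := b)
    rw [SimpleGraph.dist_eq_one_iff_adj.2 h] at h2
    rw [SimpleGraph.Walk.length_cons] at hw
    omega

lemma dist_of_adj (hT : T.IsTree) {a z : V} (h : T.Adj a z) (b : V) :
    T.dist z b = T.dist a b + 1 ∨ T.dist z b + 1 = T.dist a b := by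
  rw [T.dist_comm (u := z), T.dist_comm (u := a)]
  have := hT.dist_eq_dist_add_one_of_adj b h
  omega

/-- The first step of the geodesic between two vertices of a tree is unique. -/
lemma eq_of_adj_of_dist_lt (hT : T.IsTree) {a b z z' : V} (hz : T.Adj a z) (hz' : T.Adj a z')
    (h : T.dist z b < T.dist a b) (h' : T.dist z' b < T.dist a b) : z = z' := by
  obtain ⟨w, hw⟩ := hT.connected.exists_walk_length_eq_dist z b
  obtain ⟨w', hw'⟩ := hT.connected.exists_walk_length_eq_dist z' b
  have e := dist_of_adj hT hz b
  have e' := dist_of_adj hT hz' b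
  have p1 := (w.cons hz).isPath_of_length_eq_dist (by rw [SimpleGraph.Walk.length_cons]; omega)
  have p2 := (w'.cons hz').isPath_of_length_eq_dist (by rw [SimpleGraph.Walk.length_cons]; omega)
  have := (hT.isAcyclic.subsingleton_path a b).elim ⟨_, p1⟩ ⟨_, p2⟩
  have := congrArg (fun q => q.1.snd) this
  simpa using this

/-- A set of vertices is geodesically closed if with any two of its vertices it contains the first
step, and hence all, of a geodesic between them. -/
def GeodClosed (T : SimpleGraph V) (A : Set V) : Prop :=
  ∀ a ∈ A, ∀ b ∈ A, a ≠ b → ∃ z ∈ A, T.Adj a z ∧ T.dist z b + 1 = T.dist a b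

lemma geodClosed_univ (hT : T.IsTree) : GeodClosed T Set.univ := fun _ _ _ _ hab =>
  let ⟨z, hz⟩ := exists_adj_dist_add_one hT hab
  ⟨z, trivial, hz⟩

/-- A neighbour of a geodesically closed set is only accessible through the vertex it is attached
to. -/
lemma GeodClosed.dist_of_notMem {A : Set V} (hA : GeodClosed T A) (hT : T.IsTree) {a b x : V}
    (ha : a ∈ A) (hb : b ∈ A) (hx : x ∉ A) (hax : T.Adj a x) : T.dist x b = T.dist a b + 1 := by
  refine (dist_of_adj hT hax b).resolve_right fun h => hx ?_
  have hab : a ≠ b := by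
    rintro rfl
    simp at h
  obtain ⟨z, hz, haz, hzb⟩ := hA a ha b hb hab
  rwa [eq_of_adj_of_dist_lt (b := b) hT hax haz (by omega) (by omega)]

lemma GeodClosed.insert {A : Set V} (hA : GeodClosed T A) (hT : T.IsTree) {a x : V}
    (ha : a ∈ A) (hx : x ∉ A) (hax : T.Adj a x) : GeodClosed T (insert x A) := by
  have key : ∀ b ∈ A, T.dist x b = T.dist a b + 1 := fun b hb => hA.dist_of_notMem hT ha hb hx hax
  rintro b (rfl | hb) b' (rfl | hb') hbb'
  · exact (hbb' rfl).elim
  · exact ⟨a, Or.inr ha, hax.symm, (key b' hb').symm⟩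
  · by_cases hba : b = a
    · subst hba
      exact ⟨b', Or.inl rfl, hax, by simp [SimpleGraph.dist_eq_one_iff_adj.2 hax]⟩
    · obtain ⟨z, hz, hbz, hza⟩ := hA b hb a ha hba
      refine ⟨z, Or.inr hz, hbz, ?_⟩
      rw [T.dist_comm (v := b'), T.dist_comm (v := b'), key z hz, key b hb, T.dist_comm (v := z),
        T.dist_comm (v := b), hza]
  · obtain ⟨z, hz, h⟩ := hA b hb b' hb' hbb'
    exact ⟨z, Or.inr hz, h⟩

/-! ### Partial isomorphisms of edge-coloured trees -/

variable {C : Type*} {c : V → V → C}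

/-- A finite partial isomorphism of the tree `T` with the colouring `c` of its oriented edges, given
by its graph: it preserves the distances and colours, and its domain is geodesically closed. -/
structure IsPartialIso (T : SimpleGraph V) (c : V → V → C) (p : Finset (V × V)) : Prop where
  dist_eq : ∀ u ∈ p, ∀ w ∈ p, T.dist u.1 w.1 = T.dist u.2 w.2
  color_eq : ∀ u ∈ p, ∀ w ∈ p, T.Adj u.1 w.1 → c u.1 w.1 = c u.2 w.2
  closed : ∀ u ∈ p, ∀ w ∈ p, u.1 ≠ w.1 →
    ∃ z ∈ p, T.Adj u.1 z.1 ∧ T.dist z.1 w.1 + 1 = T.dist u.1 w.1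

/-- The tree `T` with the colouring `c` of its oriented edges looks the same at every vertex: each
colour that occurs either occurs infinitely often at every vertex, or exactly once at every vertex.
Moreover, finite subtrees have a root from which they can be moved away freely. -/
structure IsHomogeneousColoring (T : SimpleGraph V) (c : V → V → C) : Prop where
  symm : ∀ x y x' y', T.Adj x y → T.Adj x' y' → c x y = c x' y' → c y x = c y' x'
  valence : ∀ x y, T.Adj x y → (∀ x', {y' | T.Adj x' y' ∧ c x' y' = c x y}.Infinite) ∨
    ∀ x', ∃! y', T.Adj x' y' ∧ c x' y' = c x y
  root : ∀ A : Finset V, GeodClosed T A → A.Nonempty →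
    ∃ t ∈ A, ∀ x ∈ A, T.Adj t x → {y | T.Adj t y ∧ c t y = c t x}.Infinite

namespace IsPartialIso

variable {p : Finset (V × V)}

lemma eq_iff (hp : IsPartialIso T c p) (hT : T.IsTree) {u w : V × V} (hu : u ∈ p) (hw : w ∈ p) :
    u.1 = w.1 ↔ u.2 = w.2 := by
  rw [← hT.connected.dist_eq_zero_iff, hp.dist_eq u hu w hw, hT.connected.dist_eq_zero_iff]

lemma adj_iff (hp : IsPartialIso T c p) {u w : V × V} (hu : u ∈ p) (hw : w ∈ p) :
    T.Adj u.1 w.1 ↔ T.Adj u.2 w.2 := by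
  rw [← SimpleGraph.dist_eq_one_iff_adj, hp.dist_eq u hu w hw, SimpleGraph.dist_eq_one_iff_adj]

lemma singleton (x y : V) : IsPartialIso T c {(x, y)} where
  dist_eq u hu w hw := by
    rw [Finset.mem_singleton] at hu hw
    subst hu hw
    simp
  color_eq u hu w hw h := by
    rw [Finset.mem_singleton] at hu hw
    subst hu hw
    simp at h
  closed u hu w hw h := by
    rw [Finset.mem_singleton] at hu hw
    subst hu hw
    simp at h

lemma image_swap [DecidableEq V] (hp : IsPartialIso T c p) (hT : T.IsTree) :
    IsPartialIso T c (p.image Prod.swap) where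
  dist_eq := by
    simp only [Finset.forall_mem_image, Prod.fst_swap, Prod.snd_swap]
    exact fun u hu w hw => (hp.dist_eq u hu w hw).symm
  color_eq := by
    simp only [Finset.forall_mem_image, Prod.fst_swap, Prod.snd_swap]
    exact fun u hu w hw h => (hp.color_eq u hu w hw ((hp.adj_iff hu hw).2 h)).symm
  closed := by
    simp only [Finset.forall_mem_image, Prod.fst_swap, Finset.exists_mem_image]
    intro u hu w hw h
    obtain ⟨z, hz, h1, h2⟩ := hp.closed u hu w hw (mt (hp.eq_iff hT hu hw).1 h)
    refine ⟨z, hz, (hp.adj_iff hu hz).1 h1, ?_⟩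
    rwa [← hp.dist_eq z hz w hw, ← hp.dist_eq u hu w hw]

lemma geodClosed_fst (hp : IsPartialIso T c p) : GeodClosed T (Prod.fst '' (p : Set (V × V))) := by
  rintro _ ⟨u, hu, rfl⟩ _ ⟨w, hw, rfl⟩ huw
  obtain ⟨z, hz, h⟩ := hp.closed u hu w hw huw
  exact ⟨z.1, ⟨z, hz, rfl⟩, h⟩

lemma geodClosed_snd (hp : IsPartialIso T c p) (hT : T.IsTree) :
    GeodClosed T (Prod.snd '' (p : Set (V × V))) := by
  rintro _ ⟨u, hu, rfl⟩ _ ⟨w, hw, rfl⟩ huw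
  obtain ⟨z, hz, h1, h2⟩ := hp.closed u hu w hw (mt (hp.eq_iff hT hu hw).1 huw)
  refine ⟨z.2, ⟨z, hz, rfl⟩, (hp.adj_iff hu hz).1 h1, ?_⟩
  rwa [← hp.dist_eq z hz w hw, ← hp.dist_eq u hu w hw]

lemma insert [DecidableEq V] (hp : IsPartialIso T c p) (hT : T.IsTree)
    (hc : IsHomogeneousColoring T c) {u : V × V} (hu : u ∈ p) {x y : V} (hux : T.Adj u.1 x)
    (hx : ∀ w ∈ p, w.1 ≠ x) (huy : T.Adj u.2 y) (hy : ∀ w ∈ p, w.2 ≠ y)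
    (hxy : c u.1 x = c u.2 y) : IsPartialIso T c (insert (x, y) p) := by
  have hx' : x ∉ Prod.fst '' (p : Set (V × V)) := by
    rintro ⟨w, hw, rfl⟩
    exact hx w hw rfl
  have hy' : y ∉ Prod.snd '' (p : Set (V × V)) := by
    rintro ⟨w, hw, rfl⟩
    exact hy w hw rfl
  have d1 : ∀ w ∈ p, T.dist x w.1 = T.dist u.1 w.1 + 1 := fun w hw =>
    hp.geodClosed_fst.dist_of_notMem hT ⟨u, hu, rfl⟩ ⟨w, hw, rfl⟩ hx' hux
  have d2 : ∀ w ∈ p, T.dist y w.2 = T.dist u.2 w.2 + 1 := fun w hw =>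
    (hp.geodClosed_snd hT).dist_of_notMem hT ⟨u, hu, rfl⟩ ⟨w, hw, rfl⟩ hy' huy
  have d3 : ∀ w ∈ p, T.dist x w.1 = T.dist y w.2 := fun w hw => by
    rw [d1 w hw, d2 w hw, hp.dist_eq u hu w hw]
  have hadj : ∀ w ∈ p, T.Adj x w.1 → w = u := fun w hw h => by
    have h1 := d1 w hw
    rw [SimpleGraph.dist_eq_one_iff_adj.2 h] at h1
    have h2 : u.1 = w.1 := hT.connected.dist_eq_zero_iff.1 (by omega)
    exact Prod.ext h2.symm ((hp.eq_iff hT hu hw).1 h2).symm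
  refine ⟨?_, ?_, ?_⟩
  · simp only [Finset.forall_mem_insert]
    refine ⟨⟨by simp, d3⟩, fun w hw => ⟨?_, fun w' hw' => hp.dist_eq w hw w' hw'⟩⟩
    rw [T.dist_comm, T.dist_comm (u := w.2), d3 w hw]
  · simp only [Finset.forall_mem_insert]
    refine ⟨⟨by simp, fun w hw h => ?_⟩, fun w hw =>
      ⟨fun h => ?_, fun w' hw' => hp.color_eq w hw w' hw'⟩⟩
    · obtain rfl := hadj w hw h
      exact hc.symm _ _ _ _ hux huy hxy
    · obtain rfl := hadj w hw h.symm
      exact hxy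
  · have h := hp.geodClosed_fst.insert hT ⟨u, hu, rfl⟩ hx' hux
    have e : Insert.insert x (Prod.fst '' (p : Set (V × V))) =
        Prod.fst '' ((Insert.insert (x, y) p : Finset (V × V)) : Set (V × V)) := by
      rw [Finset.coe_insert, Set.image_insert_eq]
    rw [e] at h
    intro w hw w' hw' hne
    obtain ⟨_, ⟨z, hz, rfl⟩, h'⟩ := h w.1 ⟨w, hw, rfl⟩ w'.1 ⟨w', hw', rfl⟩ hne
    exact ⟨z, hz, h'⟩

/-- The local extension property. When there are infinitely many candidates for the image of the new
vertex, a finite set can be avoided. -/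
lemma exists_image (hp : IsPartialIso T c p)
    (hc : IsHomogeneousColoring T c) {u : V × V} (hu : u ∈ p) {x : V} (hux : T.Adj u.1 x)
    (hx : ∀ w ∈ p, w.1 ≠ x) (B : Finset V) :
    ∃ y, T.Adj u.2 y ∧ (∀ w ∈ p, w.2 ≠ y) ∧ c u.1 x = c u.2 y ∧
      ({y | T.Adj u.2 y ∧ c u.2 y = c u.1 x}.Infinite → y ∉ B) := by
  classical
  by_cases hinf : {y | T.Adj u.2 y ∧ c u.2 y = c u.1 x}.Infinite
  · obtain ⟨y, ⟨h1, h2⟩, h3⟩ := hinf.exists_notMem_finset (B ∪ p.image Prod.snd)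
    rw [Finset.mem_union, not_or] at h3
    exact ⟨y, h1, fun w hw h => h3.2 (h ▸ Finset.mem_image_of_mem _ hw), h2.symm, fun _ => h3.1⟩
  · have huniq := (hc.valence _ _ hux).resolve_left fun h => hinf (h u.2)
    obtain ⟨y, ⟨h1, h2⟩, -⟩ := huniq u.2
    refine ⟨y, h1, ?_, h2.symm, fun h => (hinf h).elim⟩
    rintro w hw rfl
    have h3 := (hp.adj_iff hu hw).2 h1
    exact hx w hw ((huniq u.1).unique ⟨h3, (hp.color_eq u hu w hw h3).trans h2⟩ ⟨hux, rfl⟩)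

/-- A family of partial isomorphisms with domains in `S` that can be extended by one adjacent vertex
of `S` at a time can be extended to any vertex of the geodesically closed set `S`. -/
lemma exists_extension_mem [DecidableEq V] (hT : T.IsTree) {Q : Finset (V × V) → Prop}
    {S : Set V} (hS : GeodClosed T S) (hQS : ∀ p, Q p → ∀ u ∈ p, u.1 ∈ S)
    (hstep : ∀ p, Q p → ∀ u ∈ p, ∀ x ∈ S, T.Adj u.1 x → (∀ w ∈ p, w.1 ≠ x) →
      ∃ y, Q (Insert.insert (x, y) p))
    (hp : Q p) (hne : p.Nonempty) {v : V} (hv : v ∈ S) :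
    ∃ q, p ⊆ q ∧ Q q ∧ ∃ w ∈ q, w.1 = v := by
  obtain ⟨u, hu⟩ := hne
  generalize hn : T.dist u.1 v = n
  induction n generalizing p u with
  | zero => exact ⟨p, subset_rfl, hp, u, hu, hT.connected.dist_eq_zero_iff.1 hn⟩
  | succ n ih =>
    have huv : u.1 ≠ v := by
      rintro h
      rw [h] at hn
      simp at hn
    obtain ⟨z, hz, huz, hzv⟩ := hS u.1 (hQS p hp u hu) v hv huv
    by_cases hzp : ∃ w ∈ p, w.1 = z
    · obtain ⟨w, hw, rfl⟩ := hzp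
      exact ih hp w hw (by omega)
    · push Not at hzp
      obtain ⟨y, hy⟩ := hstep p hp u hu z hz huz hzp
      obtain ⟨q, hq, h⟩ := ih hy (z, y) (Finset.mem_insert_self _ _) (by simp only; omega)
      exact ⟨q, (Finset.subset_insert _ _).trans hq, h⟩

lemma exists_extension_finset [DecidableEq V] (hT : T.IsTree) {Q : Finset (V × V) → Prop}
    {S : Set V} (hS : GeodClosed T S) (hQS : ∀ p, Q p → ∀ u ∈ p, u.1 ∈ S)
    (hstep : ∀ p, Q p → ∀ u ∈ p, ∀ x ∈ S, T.Adj u.1 x → (∀ w ∈ p, w.1 ≠ x) →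
      ∃ y, Q (Insert.insert (x, y) p))
    (hp : Q p) (hne : p.Nonempty) (F : Finset V) (hF : ∀ v ∈ F, v ∈ S) :
    ∃ q, p ⊆ q ∧ Q q ∧ ∀ v ∈ F, ∃ w ∈ q, w.1 = v := by
  induction F using Finset.induction_on with
  | empty => exact ⟨p, subset_rfl, hp, by simp⟩
  | insert v F _ ih =>
    rw [Finset.forall_mem_insert] at hF
    obtain ⟨q, hpq, hq, h⟩ := ih hF.2
    obtain ⟨r, hqr, hr, h'⟩ := exists_extension_mem hT hS hQS hstep hq (hne.mono hpq) hF.1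
    refine ⟨r, hpq.trans hqr, hr, ?_⟩
    rw [Finset.forall_mem_insert]
    exact ⟨h', fun w hw => let ⟨z, hz, e⟩ := h w hw; ⟨z, hqr hz, e⟩⟩

lemma exists_insert [DecidableEq V] (hT : T.IsTree) (hc : IsHomogeneousColoring T c)
    (hp : IsPartialIso T c p) {u : V × V} (hu : u ∈ p) {x : V} (hux : T.Adj u.1 x)
    (hx : ∀ w ∈ p, w.1 ≠ x) : ∃ y, IsPartialIso T c (Insert.insert (x, y) p) := by
  obtain ⟨y, h1, h2, h3, -⟩ := hp.exists_image hc hu hux hx ∅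
  exact ⟨y, hp.insert hT hc hu hux hx h1 h2 h3⟩

/-- Homogeneity: partial isomorphisms extend to automorphisms. -/
theorem exists_perm [Countable V] (hT : T.IsTree) (hc : IsHomogeneousColoring T c)
    (hp : IsPartialIso T c p) (hne : p.Nonempty) :
    ∃ g : Equiv.Perm V, (∀ u ∈ p, g u.1 = u.2) ∧ (∀ x y, T.Adj (g x) (g y) ↔ T.Adj x y) ∧
      ∀ x y, T.Adj x y → c (g x) (g y) = c x y := by
  classical
  have forth : ∀ p, IsPartialIso T c p ∧ p.Nonempty → ∀ x,
      ∃ q, p ⊆ q ∧ (IsPartialIso T c q ∧ q.Nonempty) ∧ ∃ w ∈ q, w.1 = x := by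
    intro p hp x
    obtain ⟨q, hpq, hq, h⟩ := exists_extension_mem hT (geodClosed_univ hT) (fun _ _ _ _ => trivial)
      (fun p hp u hu x _ hux hx => exists_insert hT hc hp hu hux hx) hp.1 hp.2 (v := x) trivial
    exact ⟨q, hpq, ⟨hq, hp.2.mono hpq⟩, h⟩
  have back : ∀ p, IsPartialIso T c p ∧ p.Nonempty → ∀ x,
      ∃ q, p ⊆ q ∧ (IsPartialIso T c q ∧ q.Nonempty) ∧ ∃ w ∈ q, w.2 = x := by
    intro p hp x
    obtain ⟨q, hpq, hq, w, hw, h⟩ := forth _ ⟨hp.1.image_swap hT, hp.2.image _⟩ x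
    refine ⟨q.image Prod.swap, fun u hu => ?_, ⟨hq.1.image_swap hT, hq.2.image _⟩, w.swap,
      Finset.mem_image_of_mem _ hw, h⟩
    exact Finset.mem_image.2 ⟨u.swap, hpq (Finset.mem_image_of_mem _ hu), Prod.swap_swap u⟩
  obtain ⟨g, h1, h2⟩ := exists_perm_of_backAndForth
    (fun p hp u hu w hw => hp.1.eq_iff hT hu hw) forth back ⟨hp, hne⟩
  refine ⟨g, h1, fun x y => ?_, fun x y hxy => ?_⟩
  · obtain ⟨q, hq, hx, hy⟩ := h2 x y
    exact (hq.1.adj_iff hx hy).symm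
  · obtain ⟨q, hq, hx, hy⟩ := h2 x y
    exact (hq.1.color_eq _ hx _ hy hxy).symm

end IsPartialIso

lemma exists_finset_geodClosed (hT : T.IsTree) (hc : IsHomogeneousColoring T c) (F : Finset V) :
    ∃ A : Finset V, F ⊆ A ∧ A.Nonempty ∧ GeodClosed T A := by
  classical
  obtain ⟨x⟩ := hT.connected.nonempty
  obtain ⟨q, hpq, hq, h⟩ := IsPartialIso.exists_extension_finset hT (geodClosed_univ hT)
    (fun _ _ _ _ => trivial) (fun p hp u hu x _ hux hx => hp.exists_insert hT hc hu hux hx)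
    (IsPartialIso.singleton (T := T) (c := c) x x) (Finset.singleton_nonempty _) F
    (fun _ _ => trivial)
  refine ⟨q.image Prod.fst, fun v hv => ?_,
    ((Finset.singleton_nonempty _).mono hpq).image _, ?_⟩
  · obtain ⟨w, hw, rfl⟩ := h v hv
    exact Finset.mem_image_of_mem _ hw
  · rw [Finset.coe_image]
    exact hq.geodClosed_fst

end Tree

/-! ### Automorphism groups of edge-coloured trees -/

section TreeGroup

variable {V C G : Type*} {T : SimpleGraph V} {c : V → V → C} [Group G] {φ : G →* Equiv.Perm V}

/-- Through the action `φ`, the group `G` acts as the full group of automorphisms of the tree `T`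
that preserve the colouring `c` of its oriented edges. -/
def IsColoredAut (T : SimpleGraph V) (c : V → V → C) (φ : G →* Equiv.Perm V) : Prop :=
  ∀ g : Equiv.Perm V, (∃ k, φ k = g) ↔
    (∀ x y, T.Adj (g x) (g y) ↔ T.Adj x y) ∧ ∀ x y, T.Adj x y → c (g x) (g y) = c x y

lemma dist_iso (g : T ≃g T) (x y : V) : T.dist (g x) (g y) = T.dist x y := by
  have key : ∀ (g : T ≃g T) (x y : V), T.Reachable x y → T.dist (g x) (g y) ≤ T.dist x y := by
    intro g x y h
    obtain ⟨w, hw⟩ := h.exists_walk_length_eq_dist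
    rw [← hw, ← SimpleGraph.Walk.length_map g.toHom w]
    exact SimpleGraph.dist_le _
  by_cases h : T.Reachable x y
  · refine le_antisymm (key g x y h) ?_
    have := key g.symm (g x) (g y) (h.map g.toHom)
    rwa [g.symm_apply_apply, g.symm_apply_apply] at this
  · rw [SimpleGraph.dist_eq_zero_of_not_reachable h, SimpleGraph.dist_eq_zero_of_not_reachable]
    rwa [g.reachable_iff]

namespace IsColoredAut

lemma adj_iff (hφ : IsColoredAut T c φ) (k : G) (x y : V) :
    T.Adj (φ k x) (φ k y) ↔ T.Adj x y :=
  ((hφ _).1 ⟨k, rfl⟩).1 x y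

lemma color_eq (hφ : IsColoredAut T c φ) (k : G) {x y : V} (h : T.Adj x y) :
    c (φ k x) (φ k y) = c x y :=
  ((hφ _).1 ⟨k, rfl⟩).2 x y h

lemma dist_eq (hφ : IsColoredAut T c φ) (k : G) (x y : V) :
    T.dist (φ k x) (φ k y) = T.dist x y :=
  dist_iso ⟨φ k, @fun x y => hφ.adj_iff k x y⟩ x y

lemma isInvariantDist (hφ : IsColoredAut T c φ) (hT : T.IsTree) :
    IsInvariantDist φ (graphDist T) where
  self x := by simp [graphDist]
  comm x y := by rw [graphDist, graphDist, T.dist_comm]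
  triangle x y z := by
    unfold graphDist
    exact_mod_cast hT.connected.dist_triangle
  map g x y := by rw [graphDist, graphDist, hφ.dist_eq]

variable [Countable V]

lemma exists_extension (hφ : IsColoredAut T c φ) (hT : T.IsTree)
    (hc : IsHomogeneousColoring T c) {p : Finset (V × V)} (hp : IsPartialIso T c p)
    (hne : p.Nonempty) : ∃ k, ∀ u ∈ p, φ k u.1 = u.2 := by
  obtain ⟨g, h1, h2⟩ := hp.exists_perm hT hc hne
  obtain ⟨k, rfl⟩ := (hφ g).2 h2
  exact ⟨k, h1⟩

lemma exists_map_eq (hφ : IsColoredAut T c φ) (hT : T.IsTree)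
    (hc : IsHomogeneousColoring T c) (x y : V) : ∃ k, φ k x = y := by
  obtain ⟨k, hk⟩ := hφ.exists_extension hT hc (IsPartialIso.singleton x y)
    (Finset.singleton_nonempty _)
  exact ⟨k, hk _ (Finset.mem_singleton_self _)⟩

/-- The stabiliser of a vertex acts transitively on the edges of given colour at it. -/
lemma exists_map_adj (hφ : IsColoredAut T c φ) (hT : T.IsTree)
    (hc : IsHomogeneousColoring T c) {t x y : V} (hx : T.Adj t x) (hy : T.Adj t y)
    (hxy : c t x = c t y) : ∃ k, φ k t = t ∧ φ k x = y := by
  classical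
  have hp : IsPartialIso T c {(x, y), (t, t)} :=
    (IsPartialIso.singleton t t).insert hT hc (Finset.mem_singleton_self _) hx
      (by simpa using hx.ne) hy (by simpa using hy.ne) hxy
  obtain ⟨k, hk⟩ := hφ.exists_extension hT hc hp (Finset.insert_nonempty _ _)
  exact ⟨k, hk (t, t) (by simp), hk (x, y) (by simp)⟩

/-- A finite subtree rooted at `t` can be moved, fixing `t`, so that it only meets a given finite
subtree in `t`. -/
lemma exists_independent (hφ : IsColoredAut T c φ) (hT : T.IsTree)
    (hc : IsHomogeneousColoring T c) {A B : Finset V} (hA : GeodClosed T A) (hB : GeodClosed T B)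
    {t : V} (htA : t ∈ A) (htB : t ∈ B)
    (ht : ∀ x ∈ A, T.Adj t x → {y | T.Adj t y ∧ c t y = c t x}.Infinite) :
    ∃ h, φ h t = t ∧ ∀ a ∈ A, ∀ b ∈ B, T.dist (φ h a) b = T.dist a t + T.dist t b := by
  classical
  -- partial embeddings of `A` whose values can be reached from `B` only through `t`
  let Q : Finset (V × V) → Prop := fun p => IsPartialIso T c p ∧ (t, t) ∈ p ∧
    (∀ u ∈ p, u.1 ∈ A) ∧ ∀ u ∈ p, ∀ b ∈ B, T.dist u.2 b = T.dist u.2 t + T.dist t b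
  have hstep : ∀ p, Q p → ∀ u ∈ p, ∀ x ∈ (A : Set V), T.Adj u.1 x → (∀ w ∈ p, w.1 ≠ x) →
      ∃ y, Q (insert (x, y) p) := by
    rintro p ⟨hp, htp, hpA, hpB⟩ u hu x hxA hux hx
    obtain ⟨y, huy, hy, hcy, hyB⟩ := hp.exists_image hc hu hux hx B
    refine ⟨y, hp.insert hT hc hu hux hx huy hy hcy, Finset.mem_insert_of_mem htp, ?_, ?_⟩
    · rw [Finset.forall_mem_insert]
      exact ⟨hxA, hpA⟩
    rw [Finset.forall_mem_insert]
    refine ⟨fun b hb => ?_, hpB⟩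
    change T.dist y b = T.dist y t + T.dist t b
    by_cases hut : u.2 = t
    · -- the new vertex is attached to the root: it has been chosen outside `B`
      have hut' : u.1 = t := (hp.eq_iff hT hu htp).2 hut
      rw [hut] at huy hyB
      rw [hut'] at hux hyB
      have h1 := hB.dist_of_notMem hT htB hb (hyB (ht x hxA hux)) huy
      have h2 : T.dist y t = 1 := SimpleGraph.dist_eq_one_iff_adj.2 huy.symm
      omega
    · -- the new vertex is further away from the root, since the next vertex towards the root
      -- already belongs to the range
      have hy' : y ∉ Prod.snd '' (p : Set (V × V)) := by
        rintro ⟨w, hw, rfl⟩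
        exact hy w hw rfl
      have h1 := (hp.geodClosed_snd hT).dist_of_notMem hT ⟨u, hu, rfl⟩ ⟨_, htp, rfl⟩ hy' huy
      simp only at h1
      have h2 := hpB u hu b hb
      rcases dist_of_adj hT huy b with h3 | h3
      · omega
      · obtain ⟨_, ⟨z, hz, rfl⟩, huz, hzt⟩ := hp.geodClosed_snd hT u.2 ⟨u, hu, rfl⟩ t
          ⟨_, htp, rfl⟩ hut
        have h4 := hT.connected.dist_triangle (u := z.2) (v := t) (w := b)
        exact (hy z hz (eq_of_adj_of_dist_lt hT huz huy (b := b) (by omega) (by omega))).elim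
  have hQ : Q {(t, t)} := ⟨IsPartialIso.singleton t t, Finset.mem_singleton_self _,
    by simpa using htA, by simp⟩
  obtain ⟨p, -, ⟨hp, htp, -, hpB⟩, hpA⟩ := IsPartialIso.exists_extension_finset hT (S := A) hA
    (fun p hp => hp.2.2.1) hstep hQ (Finset.singleton_nonempty _) A (fun _ h => h)
  obtain ⟨h, hh⟩ := hφ.exists_extension hT hc hp ⟨_, htp⟩
  refine ⟨h, hh _ htp, fun a ha b hb => ?_⟩
  obtain ⟨u, hu, rfl⟩ := hpA a ha
  rw [hh u hu, hpB u hu b hb, hp.dist_eq u hu _ htp]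

/-- Two translates of a finite subtree `A` rooted at `t` that only meet `A` in `t` are conjugate
over `A`. -/
lemma exists_conj (hφ : IsColoredAut T c φ) (hT : T.IsTree)
    (hc : IsHomogeneousColoring T c) {A : Finset V} (hA : GeodClosed T A) {t : V} (htA : t ∈ A)
    {f h : G} (hft : φ f t = t)
    (hf : ∀ a ∈ A, ∀ b ∈ A, T.dist (φ f a) b = T.dist a t + T.dist t b) (hht : φ h t = t)
    (hh : ∀ a ∈ A, ∀ b ∈ A, T.dist (φ h a) b = T.dist a t + T.dist t b) :
    ∃ v, (∀ a ∈ A, φ v a = a) ∧ ∀ a ∈ A, φ v (φ f a) = φ h a := by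
  classical
  have hzero : ∀ {a}, T.dist a t = 0 → a = t := fun h => hT.connected.dist_eq_zero_iff.1 h
  -- the only edges between `A` and its translate by `f` are edges of one of them at `t`
  have hor : ∀ a ∈ A, ∀ b ∈ A, T.Adj (φ f a) b → a = t ∨ b = t := by
    intro a ha b hb hab
    have h1 := hf a ha b hb
    rw [SimpleGraph.dist_eq_one_iff_adj.2 hab] at h1
    rcases Nat.eq_zero_or_pos (T.dist a t) with h2 | h2
    · exact Or.inl (hzero h2)
    · exact Or.inr (hzero (by rw [T.dist_comm]; omega))
  have hadj : ∀ k : G, φ k t = t → ∀ x, T.Adj t (φ k x) ↔ T.Adj t x := by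
    intro k hk x
    have := hφ.adj_iff k t x
    rwa [hk] at this
  have hcol : ∀ k : G, φ k t = t → ∀ x, T.Adj t x → c t (φ k x) = c t x := by
    intro k hk x hx
    have := hφ.color_eq k hx
    rwa [hk] at this
  have hcol' : ∀ k : G, φ k t = t → ∀ x, T.Adj x t → c (φ k x) t = c x t := by
    intro k hk x hx
    have := hφ.color_eq k hx
    rwa [hk] at this
  -- the identity on `A` together with `h f⁻¹` on the translate of `A` by `f`
  have hp : IsPartialIso T c
      (A.image (fun a => (a, a)) ∪ A.image (fun a => (φ f a, φ h a))) := by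
    refine ⟨?_, ?_, ?_⟩
    · simp only [Finset.forall_mem_union, Finset.forall_mem_image]
      refine ⟨fun a ha => ⟨fun b hb => trivial, fun b hb => ?_⟩, fun a ha => ⟨fun b hb => ?_,
        fun b hb => ?_⟩⟩
      · rw [T.dist_comm, hf b hb a ha, T.dist_comm (u := a), hh b hb a ha]
      · rw [hf a ha b hb, hh a ha b hb]
      · rw [hφ.dist_eq, hφ.dist_eq]
    · simp only [Finset.forall_mem_union, Finset.forall_mem_image]
      refine ⟨fun a ha => ⟨fun b hb _ => trivial, fun b hb hab => ?_⟩, fun a ha =>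
        ⟨fun b hb hab => ?_, fun b hb hab => ?_⟩⟩
      · rcases hor b hb a ha hab.symm with rfl | rfl
        · rw [hft, hht]
        · rw [hadj f hft] at hab
          rw [hcol f hft b hab, hcol h hht b hab]
      · rcases hor a ha b hb hab with rfl | rfl
        · rw [hft, hht]
        · have hab' : T.Adj a b := ((hadj f hft a).1 hab.symm).symm
          rw [hcol' f hft a hab', hcol' h hht a hab']
      · rw [hφ.adj_iff] at hab
        rw [hφ.color_eq f hab, hφ.color_eq h hab]
    · simp only [Finset.forall_mem_union, Finset.forall_mem_image]
      have inl : ∀ z ∈ A, (z, z) ∈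
          A.image (fun a => (a, a)) ∪ A.image (fun a => (φ f a, φ h a)) := fun z hz =>
        Finset.mem_union_left _ (Finset.mem_image_of_mem (fun a => (a, a)) hz)
      have inr : ∀ z ∈ A, (φ f z, φ h z) ∈
          A.image (fun a => (a, a)) ∪ A.image (fun a => (φ f a, φ h a)) := fun z hz =>
        Finset.mem_union_right _ (Finset.mem_image_of_mem (fun a => (φ f a, φ h a)) hz)
      refine ⟨fun a ha => ⟨fun b hb hab => ?_, fun b hb hab => ?_⟩, fun a ha =>
        ⟨fun b hb hab => ?_, fun b hb hab => ?_⟩⟩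
      · obtain ⟨z, hz, h1⟩ := hA a ha b hb hab
        exact ⟨_, inl z hz, h1⟩
      · by_cases hat : a = t
        · subst hat
          have hab' : a ≠ b := by
            rintro rfl
            exact hab hft.symm
          obtain ⟨z, hz, h1, h2⟩ := hA a htA b hb hab'
          refine ⟨_, inr z hz, (hadj f hft z).2 h1, ?_⟩
          change T.dist (φ f z) (φ f b) + 1 = T.dist a (φ f b)
          rw [hφ.dist_eq, T.dist_comm (u := a), hf b hb a ha, h2, T.dist_comm (u := a)]
          simp
        · obtain ⟨z, hz, h1, h2⟩ := hA a ha t htA hat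
          refine ⟨_, inl z hz, h1, ?_⟩
          change T.dist z (φ f b) + 1 = T.dist a (φ f b)
          rw [T.dist_comm, hf b hb z hz, T.dist_comm (u := a), hf b hb a ha, T.dist_comm (u := t),
            T.dist_comm (u := t), ← h2, add_assoc]
      · by_cases hat : a = t
        · subst hat
          change φ f a ≠ b at hab
          rw [hft] at hab
          obtain ⟨z, hz, h1⟩ := hA a htA b hb hab
          refine ⟨_, inl z hz, ?_⟩
          change T.Adj (φ f a) z ∧ T.dist z b + 1 = T.dist (φ f a) b
          rwa [hft]
        · obtain ⟨z, hz, h1, h2⟩ := hA a ha t htA hat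
          refine ⟨_, inr z hz, (hφ.adj_iff f a z).2 h1, ?_⟩
          change T.dist (φ f z) b + 1 = T.dist (φ f a) b
          rw [hf z hz b hb, hf a ha b hb]
          omega
      · obtain ⟨z, hz, h1, h2⟩ := hA a ha b hb (fun e => hab (by rw [e]))
        refine ⟨_, inr z hz, (hφ.adj_iff f a z).2 h1, ?_⟩
        change T.dist (φ f z) (φ f b) + 1 = T.dist (φ f a) (φ f b)
        rwa [hφ.dist_eq, hφ.dist_eq]
  obtain ⟨v, hv⟩ := hφ.exists_extension hT hc hp
    ⟨_, Finset.mem_union_left _ (Finset.mem_image_of_mem _ htA)⟩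
  exact ⟨v, fun a ha => hv (a, a) (Finset.mem_union_left _ (Finset.mem_image_of_mem _ ha)),
    fun a ha => hv (φ f a, φ h a) (Finset.mem_union_right _
      (Finset.mem_image_of_mem (fun a => (φ f a, φ h a)) ha))⟩

lemma exists_bddOn_stabilizer (hφ : IsColoredAut T c φ) (hT : T.IsTree)
    (hc : IsHomogeneousColoring T c) {L : G → ℝ} (hL : IsLength φ L) :
    ∃ t D, ∀ g, φ g t = t → L g ≤ D := by
  classical
  obtain ⟨A₀, hA₀⟩ := hL.small
  obtain ⟨A, hA₀A, hne, hA⟩ := exists_finset_geodClosed hT hc A₀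
  obtain ⟨t, htA, ht⟩ := hc.root A hA hne
  refine ⟨t, hL.bddOn_stabilizer (A := A) (fun g hg => hA₀ g fun x hx => hg x (hA₀A hx))
    (P := fun h => φ h t = t ∧ ∀ a ∈ A, ∀ b ∈ A, T.dist (φ h a) b = T.dist a t + T.dist t b)
    (fun g hg => ?_) (fun f h hf hh => hφ.exists_conj hT hc hA htA hf.1 hf.2 hh.1 hh.2)⟩
  obtain ⟨B, hAB, -, hB⟩ := exists_finset_geodClosed hT hc (A ∪ A.image (φ g))
  obtain ⟨h, h1, h2⟩ := hφ.exists_independent hT hc hA hB htA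
    (hAB (Finset.mem_union_left _ htA)) ht
  refine ⟨h, ⟨h1, fun a ha b hb => h2 a ha b (hAB (Finset.mem_union_left _ hb))⟩, ?_,
    fun a ha b hb => ?_⟩
  · rw [map_mul, map_inv, Equiv.Perm.mul_apply, h1, Equiv.Perm.inv_eq_iff_eq, hg]
  · rw [← hφ.dist_eq g, map_mul, Equiv.Perm.mul_apply, apply_apply_inv,
      h2 a ha _ (hAB (Finset.mem_union_right _ (Finset.mem_image_of_mem _ hb)))]
    have := hφ.dist_eq g t b
    rw [hg] at this
    rw [this]

/-- The group is generated by the stabiliser of a vertex together with one element for each colour,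
and the word length is bounded by the displacement of the vertex. -/
theorem orbitControlsLengths [Finite C] (hφ : IsColoredAut T c φ) (hT : T.IsTree)
    (hc : IsHomogeneousColoring T c) (x₀ : V) : OrbitControlsLengths φ (graphDist T) x₀ := by
  intro L hL
  obtain ⟨t, D, hD⟩ := hφ.exists_bddOn_stabilizer hT hc hL
  have hu : ∀ k : C, ∃ u, (∃ y, T.Adj t y ∧ c t y = k) → T.Adj t (φ u t) ∧ c t (φ u t) = k := by
    intro k
    by_cases hk : ∃ y, T.Adj t y ∧ c t y = k
    · obtain ⟨y, hy⟩ := hk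
      obtain ⟨u, rfl⟩ := hφ.exists_map_eq hT hc t y
      exact ⟨u, fun _ => hy⟩
    · exact ⟨1, fun h => (hk h).elim⟩
  choose u hu using hu
  obtain ⟨M, hM⟩ := (Set.finite_range fun k => L (u k)).bddAbove
  have hM' : ∀ k, L (u k) ≤ M := fun k => hM ⟨k, rfl⟩
  have key : ∀ n : ℕ, ∀ g, T.dist t (φ g t) = n → L g ≤ n * (D + M) + D := by
    intro n
    induction n with
    | zero =>
      intro g hg
      simpa using hD g (hT.connected.dist_eq_zero_iff.1 hg).symm
    | succ n ih =>
      intro g hg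
      have hne : t ≠ φ g t := by
        intro h
        rw [← h] at hg
        simp at hg
      obtain ⟨z, hz, hzg⟩ := exists_adj_dist_add_one hT hne
      obtain ⟨h1, h2⟩ := hu (c t z) ⟨z, hz, rfl⟩
      obtain ⟨k, hkt, hkz⟩ := hφ.exists_map_adj hT hc h1 hz h2
      have h3 := ih ((k * u (c t z))⁻¹ * g) (by
        rw [← hφ.dist_eq (k * u (c t z)), map_mul φ _ g, Equiv.Perm.mul_apply _ _ t,
          apply_apply_inv, map_mul, Equiv.Perm.mul_apply, hkz]
        omega)
      have h4 := hL.mul_le (k * u (c t z)) ((k * u (c t z))⁻¹ * g)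
      rw [mul_inv_cancel_left] at h4
      have h5 := hL.mul_le k (u (c t z))
      have h6 := hD k hkt
      have h7 := hM' (c t z)
      push_cast
      linarith
  have hD0 : 0 ≤ D := hL.one ▸ hD 1 (by simp)
  have hDM : 0 ≤ D + |M| := by positivity
  refine ⟨(D + |M|) * (2 * T.dist t x₀ + 1) + D, fun g => ?_⟩
  have h1 := key _ g rfl
  have h2 : (T.dist t (φ g t) : ℝ) ≤ graphDist T x₀ (φ g x₀) + 2 * T.dist t x₀ := by
    have h3 := hT.connected.dist_triangle (u := t) (v := x₀) (w := φ g t)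
    have h4 := hT.connected.dist_triangle (u := x₀) (v := φ g x₀) (w := φ g t)
    rw [hφ.dist_eq, T.dist_comm (u := x₀) (v := t)] at h4
    have h5 : T.dist t (φ g t) ≤ T.dist x₀ (φ g x₀) + 2 * T.dist t x₀ := by omega
    unfold graphDist
    exact_mod_cast h5
  have h3 : (0 : ℝ) ≤ graphDist T x₀ (φ g x₀) := Nat.cast_nonneg _
  have h4 : (0 : ℝ) ≤ T.dist t x₀ := Nat.cast_nonneg _
  have h5 : (T.dist t (φ g t) : ℝ) * (D + M) ≤
      (graphDist T x₀ (φ g x₀) + 2 * T.dist t x₀) * (D + |M|) :=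
    (mul_le_mul_of_nonneg_left (by linarith [le_abs_self M]) (Nat.cast_nonneg _)).trans
      (mul_le_mul_of_nonneg_right h2 hDM)
  have h6 : 0 ≤ (D + |M|) * (2 * T.dist t x₀) * graphDist T x₀ (φ g x₀) := by positivity
  have h7 : 0 ≤ D * graphDist T x₀ (φ g x₀) := by positivity
  nlinarith

end IsColoredAut

end TreeGroup

section Aut

variable {V : Type*} {T : SimpleGraph V}

/-! ### The automorphism group of the regular tree -/

/-- The permutations of the vertices given by the automorphisms of a graph. -/
def autHom (T : SimpleGraph V) : (T ≃g T) →* Equiv.Perm V where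
  toFun g := g.toEquiv
  map_one' := rfl
  map_mul' _ _ := rfl

lemma autHom_injective : Function.Injective (autHom T) := fun g h hgh => by
  ext x
  exact congrFun (congrArg (fun e : Equiv.Perm V => (e : V → V)) hgh) x

lemma isPermTopology_autHom : IsPermTopology (autHom T) (permTopology (T ≃g T) V) :=
  fun _ => Iff.rfl

lemma isColoredAut_autHom : IsColoredAut T (fun _ _ => ()) (autHom T) := by
  refine fun g => ⟨?_, fun h => ⟨⟨g, @fun x y => h.1 x y⟩, rfl⟩⟩
  rintro ⟨k, rfl⟩
  exact ⟨fun x y => k.map_adj_iff, fun _ _ _ => rfl⟩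

lemma IsAlephZeroRegularTree.isHomogeneousColoring (hT : IsAlephZeroRegularTree T) :
    IsHomogeneousColoring T (fun _ _ => ()) where
  symm _ _ _ _ _ _ _ := rfl
  valence _ _ _ := Or.inl fun x' => (hT.infinite_valence x').mono fun _ hy => ⟨hy, rfl⟩
  root A _ hA := by
    obtain ⟨t, ht⟩ := hA
    exact ⟨t, ht, fun _ _ _ => (hT.infinite_valence t).mono fun _ hy => ⟨hy, rfl⟩⟩

/-! ### The stabiliser of an end -/

/-- The colouring of the oriented edges of a tree induced by an infinite path: the edge from `x` to
`y` points towards the end defined by the path. -/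
def PointsTo (v : InfinitePath T) (x y : V) : Prop :=
  ∀ᶠ n in Filter.atTop, T.dist y (v.toFun n) < T.dist x (v.toFun n)

/-- Infinite paths in a tree are geodesic. -/
lemma InfinitePath.dist_eq (hT : T.IsTree) (v : InfinitePath T) (m n : ℕ) :
    T.dist (v.toFun m) (v.toFun (m + n)) = n := by
  induction n using Nat.twoStepInduction with
  | zero => simp
  | one => exact SimpleGraph.dist_eq_one_iff_adj.2 (v.adj m)
  | more n h1 h2 =>
    rw [T.dist_comm] at h1 h2 ⊢
    rcases dist_of_adj hT (v.adj (m + (n + 1))) (v.toFun m) with h | h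
    · rw [h2] at h
      exact h
    · have h3 := eq_of_adj_of_dist_lt hT (b := v.toFun m) (v.adj (m + (n + 1)))
        (v.adj (m + n)).symm (by omega) (by omega)
      have h4 := v.injective h3
      omega

/-- Seen from any vertex, an infinite path eventually moves away. -/
lemma InfinitePath.exists_forall_dist_eq (hT : T.IsTree) (v : InfinitePath T) (x : V) :
    ∃ N, ∀ k, T.dist x (v.toFun (N + k)) = T.dist x (v.toFun N) + k := by
  have hstep : ∀ n, T.dist x (v.toFun (n + 1)) = T.dist x (v.toFun n) + 1 ∨
      T.dist x (v.toFun (n + 1)) + 1 = T.dist x (v.toFun n) := fun n => by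
    rw [T.dist_comm, T.dist_comm (u := x)]
    exact dist_of_adj hT (v.adj n) x
  have hmono : ∀ n, T.dist x (v.toFun (n + 1)) = T.dist x (v.toFun n) + 1 →
      T.dist x (v.toFun (n + 2)) = T.dist x (v.toFun (n + 1)) + 1 := by
    intro n hn
    refine (hstep (n + 1)).resolve_right fun h => ?_
    have h3 := eq_of_adj_of_dist_lt hT (b := x) (v.adj (n + 1)) (v.adj n).symm
      (by rw [T.dist_comm, T.dist_comm (v := x)]; omega)
      (by rw [T.dist_comm, T.dist_comm (v := x)]; omega)
    have h4 := v.injective h3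
    omega
  have hex : ∃ N, T.dist x (v.toFun (N + 1)) = T.dist x (v.toFun N) + 1 := by
    by_contra! hcon
    have : ∀ n, T.dist x (v.toFun n) + n = T.dist x (v.toFun 0) := by
      intro n
      induction n with
      | zero => rfl
      | succ n ih =>
        have := (hstep n).resolve_left (hcon n)
        omega
    have := this (T.dist x (v.toFun 0) + 1)
    omega
  obtain ⟨N, hN⟩ := hex
  have hall : ∀ k, T.dist x (v.toFun (N + k + 1)) = T.dist x (v.toFun (N + k)) + 1 := by
    intro k
    induction k with
    | zero => exact hN
    | succ k ih => exact hmono _ ih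
  refine ⟨N, fun k => ?_⟩
  induction k with
  | zero => rfl
  | succ k ih =>
    have := hall k
    rw [← add_assoc]
    omega

lemma PointsTo.unique (hT : T.IsTree) {v : InfinitePath T} {x y y' : V} (hy : T.Adj x y)
    (hy' : T.Adj x y') (h : PointsTo v x y) (h' : PointsTo v x y') : y = y' := by
  obtain ⟨n, h1, h2⟩ := (h.and h').exists
  exact eq_of_adj_of_dist_lt hT hy hy' h1 h2

/-- A vertex that is closer to the `n`-th vertex of the path points towards its end, provided the
path moves away from `x` from there on. -/
lemma pointsTo_of_dist_lt (hT : T.IsTree) (v : InfinitePath T) {x z : V} {n : ℕ}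
    (hx : ∀ k, T.dist x (v.toFun (n + k)) = T.dist x (v.toFun n) + k)
    (hz : T.dist z (v.toFun n) < T.dist x (v.toFun n)) : PointsTo v x z := by
  refine Filter.eventually_atTop.2 ⟨n, fun m hm => ?_⟩
  obtain ⟨k, rfl⟩ := Nat.exists_eq_add_of_le hm
  have h1 := hT.connected.dist_triangle (u := z) (v := v.toFun n) (w := v.toFun (n + k))
  rw [v.dist_eq hT] at h1
  rw [hx]
  omega

lemma InfinitePath.pointsTo_succ (hT : T.IsTree) (v : InfinitePath T) (n : ℕ) :
    PointsTo v (v.toFun n) (v.toFun (n + 1)) := by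
  refine pointsTo_of_dist_lt hT v (n := n + 1) (fun k => ?_) ?_
  · rw [add_assoc, v.dist_eq hT, v.dist_eq hT]
  · rw [v.dist_eq hT]
    simp

lemma exists_pointsTo (hT : T.IsTree) (v : InfinitePath T) (x : V) :
    ∃ z, T.Adj x z ∧ PointsTo v x z := by
  obtain ⟨N, hN⟩ := v.exists_forall_dist_eq hT x
  have hne : x ≠ v.toFun (N + 1) := by
    intro h
    have := hN 1
    rw [← h] at this
    simp at this
  obtain ⟨z, hz, h⟩ := exists_adj_dist_add_one hT hne
  refine ⟨z, hz, pointsTo_of_dist_lt hT v (n := N + 1) (fun k => ?_) (by omega)⟩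
  have h1 := hN (1 + k)
  rw [← add_assoc] at h1
  rw [h1, hN 1, add_assoc]

lemma pointsTo_comm (hT : T.IsTree) (v : InfinitePath T) {x y : V} (hxy : T.Adj x y) :
    PointsTo v y x ↔ ¬ PointsTo v x y := by
  refine ⟨fun h h' => ?_, fun h => ?_⟩
  · obtain ⟨n, h1, h2⟩ := (h.and h').exists
    omega
  · obtain ⟨N, hN⟩ := v.exists_forall_dist_eq hT x
    refine Filter.eventually_atTop.2 ⟨N, fun m hm => ?_⟩
    by_contra hcon
    refine h (pointsTo_of_dist_lt hT v (n := m) (fun k => ?_) ?_)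
    · obtain ⟨l, rfl⟩ := Nat.exists_eq_add_of_le hm
      rw [add_assoc, hN, hN, add_assoc]
    · have := dist_of_adj hT hxy (v.toFun m)
      omega

lemma IsAlephZeroRegularTree.isHomogeneousColoring_pointsTo (hT : IsAlephZeroRegularTree T)
    (v : InfinitePath T) : IsHomogeneousColoring T (PointsTo v) := by
  have hinf : ∀ x, {y | T.Adj x y ∧ ¬ PointsTo v x y}.Infinite := by
    intro x
    obtain ⟨z, hxz, hz⟩ := exists_pointsTo hT.isTree v x
    refine ((hT.infinite_valence x).sdiff (Set.finite_singleton z)).mono ?_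
    rintro y ⟨hxy, hy⟩
    exact ⟨hxy, fun h => hy (h.unique hT.isTree hxy hxz hz)⟩
  refine ⟨fun x y x' y' h h' he => ?_, fun x y _ => ?_, fun A _ hA => ?_⟩
  · rw [eq_iff_iff, pointsTo_comm hT.isTree v h, pointsTo_comm hT.isTree v h', he]
  · by_cases hxy : PointsTo v x y
    · refine Or.inr fun x' => ?_
      simp only [hxy, eq_iff_iff, iff_true]
      obtain ⟨z, hz⟩ := exists_pointsTo hT.isTree v x'
      exact ⟨z, hz, fun z' hz' => hz'.2.unique hT.isTree hz'.1 hz.1 hz.2⟩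
    · refine Or.inl fun x' => ?_
      simpa only [hxy, eq_iff_iff, iff_false] using hinf x'
  · -- the root is the vertex of `A` closest to the end
    have h1 : ∀ᶠ n in Filter.atTop, ∀ a ∈ A, ∀ x ∈ A, PointsTo v a x →
        T.dist x (v.toFun n) < T.dist a (v.toFun n) := by
      simp only [Filter.eventually_all_finset]
      intro a _ x _
      by_cases hax : PointsTo v a x
      · exact hax.mono fun n hn _ => hn
      · exact Filter.Eventually.of_forall fun n h => (hax h).elim
    obtain ⟨n, hn⟩ := h1.exists
    obtain ⟨t, ht, hmin⟩ := A.exists_min_image (fun a => T.dist a (v.toFun n)) hA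
    refine ⟨t, ht, fun x hx _ => ?_⟩
    have htx : ¬ PointsTo v t x := fun h => (hn t ht x hx h).not_ge (hmin x hx)
    simpa only [htx, eq_iff_iff, iff_false] using hinf t

/-- Every infinite path pointing towards the end of `v` eventually follows `v`. -/
lemma exists_merge (hT : T.IsTree) {v w : InfinitePath T}
    (hw : ∀ n, PointsTo v (w.toFun n) (w.toFun (n + 1))) :
    ∃ k l, ∀ n, w.toFun (k + n) = v.toFun (l + n) := by
  obtain ⟨N, hN⟩ := v.exists_forall_dist_eq hT (w.toFun 0)
  -- `w` approaches the part of `v` beyond `v N` at unit speed, until it meets `v` in `v N`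
  have key : ∀ i, i ≤ T.dist (w.toFun 0) (v.toFun N) →
      ∀ k, T.dist (w.toFun i) (v.toFun (N + k)) + i = T.dist (w.toFun 0) (v.toFun N) + k := by
    intro i
    induction i with
    | zero => exact fun _ k => hN k
    | succ i ih =>
      intro hi k
      have ih' := ih (by omega)
      have h0 := ih' 0
      rw [add_zero] at h0
      have hx : ∀ k, T.dist (w.toFun i) (v.toFun (N + k)) = T.dist (w.toFun i) (v.toFun N) + k :=
        fun k => by
          have := ih' k
          omega
      have hne : w.toFun i ≠ v.toFun N := by
        intro h
        rw [h, SimpleGraph.dist_self] at h0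
        omega
      obtain ⟨z, hz, hzN⟩ := exists_adj_dist_add_one hT hne
      obtain rfl := (hw i).unique hT (w.adj i) hz
        (pointsTo_of_dist_lt hT v hx (by omega))
      have h1 := hT.connected.dist_triangle (u := w.toFun (i + 1)) (v := v.toFun N)
        (w := v.toFun (N + k))
      rw [v.dist_eq hT] at h1
      have h2 := dist_of_adj hT hz (v.toFun (N + k))
      have h3 := hx k
      omega
  refine ⟨T.dist (w.toFun 0) (v.toFun N), N, fun n => ?_⟩
  induction n with
  | zero =>
    have := key _ le_rfl 0
    simp only [add_zero] at this ⊢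
    exact hT.connected.dist_eq_zero_iff.1 (by omega)
  | succ n ih =>
    have h1 := hw (T.dist (w.toFun 0) (v.toFun N) + n)
    have h2 := w.adj (T.dist (w.toFun 0) (v.toFun N) + n)
    rw [ih] at h1 h2
    exact h1.unique hT h2 (v.adj _) (v.pointsTo_succ hT _)

/-- The stabiliser of the end of `v` consists of the automorphisms preserving the edges pointing
towards it. -/
lemma isColoredAut_endStabilizer (hT : T.IsTree) (v : InfinitePath T) :
    IsColoredAut T (PointsTo v)
      ((autHom T).comp (endStabilizer T (Quotient.mk (pathSetoid T) v)).subtype) := by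
  refine fun g => ⟨?_, fun ⟨h1, h2⟩ => ?_⟩
  · rintro ⟨⟨k, hk⟩, rfl⟩
    refine ⟨fun x y => k.map_adj_iff, fun x y _ => ?_⟩
    change PointsTo v (k x) (k y) = PointsTo v x y
    obtain ⟨a, b, hab⟩ := Quotient.exact (s := pathSetoid T) (MulAction.mem_stabilizer_iff.1 hk)
    change ∀ n, k (v.toFun (a + n)) = v.toFun (b + n) at hab
    have shift : ∀ (i : ℕ) (P : ℕ → Prop),
        (∀ᶠ n in Filter.atTop, P (i + n)) ↔ ∀ᶠ n in Filter.atTop, P n := fun i P => by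
      simp_rw [add_comm i]
      rw [← Filter.eventually_map (m := (· + i)), Filter.map_add_atTop_eq_nat]
    rw [eq_iff_iff, PointsTo, PointsTo, ← shift b, ← shift a (fun n => T.dist y _ < T.dist x _)]
    simp only [← hab, dist_iso]
  · let k : T ≃g T := ⟨g, @fun x y => h1 x y⟩
    have hk : k ∈ endStabilizer T (Quotient.mk (pathSetoid T) v) := by
      refine MulAction.mem_stabilizer_iff.2 ?_
      refine Quotient.sound (s := pathSetoid T) (a := v.map k) ?_
      refine exists_merge hT fun n => ?_
      change PointsTo v (g (v.toFun n)) (g (v.toFun (n + 1)))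
      rw [h2 _ _ (v.adj n)]
      exact v.pointsTo_succ hT n
    exact ⟨⟨k, hk⟩, rfl⟩

lemma isPermTopology_endStabilizer (e : TreeEnd T) :
    IsPermTopology ((autHom T).comp (endStabilizer T e).subtype) (endStabilizerTopology T e) := by
  intro U
  refine ⟨?_, fun hU => ?_⟩
  · rintro ⟨W, hW, rfl⟩ g hg
    obtain ⟨A, hA⟩ := hW g hg
    exact ⟨A, fun h hh => hA h hh⟩
  · choose! A hA using hU
    refine ⟨{k | ∃ g ∈ U, ∀ x ∈ A g, k x = (g : T ≃g T) x}, ?_, ?_⟩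
    · rintro k ⟨g, hg, hk⟩
      exact ⟨A g, fun h hh => ⟨g, hg, fun x hx => (hh x hx).trans (hk x hx)⟩⟩
    · ext h
      exact ⟨fun ⟨g, hg, hh⟩ => hA g hg h hh, fun hh => ⟨h, hh, fun _ _ => rfl⟩⟩

/-! ### Quasi-isometry types for the regular tree -/

lemma IsAlephZeroRegularTree.isGroupQuasiIsometry_aut (hT : IsAlephZeroRegularTree T) (t : V) :
    IsGroupQuasiIsometry (permTopology (T ≃g T) V) (graphDist T) (fun g : T ≃g T => g t) :=
  have := hT.countable
  (isColoredAut_autHom.orbitControlsLengths hT.isTree hT.isHomogeneousColoring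
    t).isGroupQuasiIsometry autHom_injective isPermTopology_autHom
      (isColoredAut_autHom.isInvariantDist hT.isTree)
      (isColoredAut_autHom.exists_map_eq hT.isTree hT.isHomogeneousColoring t)

lemma IsAlephZeroRegularTree.isGroupQuasiIsometry_endStabilizer (hT : IsAlephZeroRegularTree T)
    (e : TreeEnd T) (t : V) :
    IsGroupQuasiIsometry (endStabilizerTopology T e) (graphDist T)
      (fun g : endStabilizer T e => (g : T ≃g T) t) := by
  have := hT.countable
  obtain ⟨v, rfl⟩ := Quotient.exists_rep e
  have hφ := isColoredAut_endStabilizer hT.isTree v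
  have hc := hT.isHomogeneousColoring_pointsTo v
  exact (hφ.orbitControlsLengths hT.isTree hc t).isGroupQuasiIsometry
    (fun _ _ h => Subtype.ext (autHom_injective h)) (isPermTopology_endStabilizer _)
    (hφ.isInvariantDist hT.isTree) (hφ.exists_map_eq hT.isTree hc t)

lemma IsAlephZeroRegularTree.isGroupQuasiIsometry_inclusion (hT : IsAlephZeroRegularTree T)
    (e : TreeEnd T) {m : MetricSpace (T ≃g T)}
    (hm : IsMaximalMetric (permTopology (T ≃g T) V) m) :
    IsGroupQuasiIsometry (endStabilizerTopology T e) m.dist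
      (fun g : endStabilizer T e => (g : T ≃g T)) := by
  obtain ⟨t⟩ := hT.isTree.connected.nonempty
  obtain ⟨h1, h2⟩ := hT.isGroupQuasiIsometry_endStabilizer e t
  exact ⟨h1, fun m' hm' => (h2 m' hm').of_comp ((hT.isGroupQuasiIsometry_aut t).2 m hm)
    fun _ => rfl⟩

end Aut

/-! ### Urysohn spaces -/

section Urysohn

variable {X : Type*} [MetricSpace X]

/-- The permutations given by the isometries of a metric space. -/
def isomHom (X : Type*) [MetricSpace X] : (X ≃ᵢ X) →* Equiv.Perm X where
  toFun g := g.toEquiv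
  map_one' := rfl
  map_mul' _ _ := rfl

lemma isomHom_injective : Function.Injective (isomHom X) := fun _ _ h =>
  IsometryEquiv.toEquiv_injective h

lemma isPermTopology_isomHom : IsPermTopology (isomHom X) (permTopology (X ≃ᵢ X) X) :=
  fun _ => Iff.rfl

lemma isInvariantDist_isomHom : IsInvariantDist (isomHom X) (fun x y : X => dist x y) where
  self := dist_self
  comm := dist_comm
  triangle := dist_triangle
  map g x y := g.dist_eq x y

namespace IsUrysohnSpace

variable {S : Set ℝ}

lemma dist_eq_zero_or_mem (hX : IsUrysohnSpace S X) (x y : X) : dist x y = 0 ∨ dist x y ∈ S := by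
  by_cases h : x = y
  · exact Or.inl (dist_eq_zero.2 h)
  · exact Or.inr (hX.dist_mem x y h)

/-- Isometries between finite families of points extend to the whole space. -/
lemma exists_isometryEquiv (hX : IsUrysohnSpace S X) {κ : Type*} [Finite κ] {p q : κ → X}
    (h : ∀ i j, dist (p i) (p j) = dist (q i) (q j)) : ∃ g : X ≃ᵢ X, ∀ i, g (p i) = q i := by
  classical
  cases nonempty_fintype κ
  have hex : ∀ a : (Finset.univ.image p : Finset X), ∃ i, p i = a := fun a => by
    obtain ⟨i, -, hi⟩ := Finset.mem_image.1 a.2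
    exact ⟨i, hi⟩
  choose i hi using hex
  obtain ⟨g, hg⟩ := hX.ultrahomogeneous (Finset.univ.image p) (fun a => q (i a))
    (Isometry.of_dist_eq fun a b => by rw [← h, hi, hi, Subtype.dist_eq])
  refine ⟨g, fun j => ?_⟩
  have h1 := hg ⟨p j, Finset.mem_image_of_mem _ (Finset.mem_univ _)⟩
  refine h1.trans (dist_eq_zero.1 ?_)
  rw [← h, hi, dist_self]

/-- Finite pseudometrics with nonzero distances in `S` are realised by families of points. -/
lemma exists_realization (hX : IsUrysohnSpace S X) {ι : Type*} [Finite ι] {d : ι → ι → ℝ}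
    (hself : ∀ i, d i i = 0) (hcomm : ∀ i j, d i j = d j i)
    (htri : ∀ i j k, d i k ≤ d i j + d j k) (hS : ∀ i j, d i j = 0 ∨ d i j ∈ S) :
    ∃ f : ι → X, ∀ i j, dist (f i) (f j) = d i j := by
  let _ : PseudoMetricSpace ι :=
    { dist := d
      dist_self := hself
      dist_comm := hcomm
      dist_triangle := htri }
  have : Finite (SeparationQuotient ι) :=
    Finite.of_surjective _ SeparationQuotient.surjective_mk
  obtain ⟨n, ⟨e⟩⟩ := Finite.exists_equiv_fin (SeparationQuotient ι)
  let m : MetricSpace (Fin n) := MetricSpace.induced e.symm e.symm.injective inferInstance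
  have hm : ∀ i j : ι, m.dist (e (SeparationQuotient.mk i)) (e (SeparationQuotient.mk j)) = d i j :=
    fun i j => by
      change dist (e.symm _) (e.symm _) = _
      rw [e.symm_apply_apply, e.symm_apply_apply, SeparationQuotient.dist_mk]
      rfl
  obtain ⟨f, hf⟩ := hX.universal n m (fun i j hij => by
    obtain ⟨i, rfl⟩ := e.surjective i
    obtain ⟨j, rfl⟩ := e.surjective j
    obtain ⟨i, rfl⟩ := SeparationQuotient.surjective_mk i
    obtain ⟨j, rfl⟩ := SeparationQuotient.surjective_mk j
    have h0 : m.dist (e (SeparationQuotient.mk i)) (e (SeparationQuotient.mk j)) ≠ 0 := fun h =>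
      hij (eq_of_dist_eq_zero h)
    rw [hm] at h0 ⊢
    exact (hS i j).resolve_left h0)
  exact ⟨fun i => f (e (SeparationQuotient.mk i)), fun i j => (hf _ _).trans (hm i j)⟩

/-- The realisation of a finite pseudometric can be prescribed on a subfamily. -/
lemma exists_realization_extending (hX : IsUrysohnSpace S X) {ι κ : Type*} [Finite ι] [Finite κ]
    {d : ι → ι → ℝ} (hself : ∀ i, d i i = 0) (hcomm : ∀ i j, d i j = d j i)
    (htri : ∀ i j k, d i k ≤ d i j + d j k) (hS : ∀ i j, d i j = 0 ∨ d i j ∈ S) (e : κ → ι)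
    (p : κ → X) (hp : ∀ i j, dist (p i) (p j) = d (e i) (e j)) :
    ∃ f : ι → X, (∀ i j, dist (f i) (f j) = d i j) ∧ ∀ i, f (e i) = p i := by
  obtain ⟨f, hf⟩ := hX.exists_realization hself hcomm htri hS
  obtain ⟨g, hg⟩ := hX.exists_isometryEquiv (p := fun i => f (e i)) (q := p)
    (fun i j => by rw [hf, hp])
  exact ⟨fun i => g (f i), fun i j => by rw [g.dist_eq, hf], hg⟩

lemma exists_map_eq (hX : IsUrysohnSpace S X) (x y : X) : ∃ g : X ≃ᵢ X, g x = y := by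
  obtain ⟨g, hg⟩ := hX.exists_isometryEquiv (p := fun _ : Unit => x) (q := fun _ => y)
    (fun _ _ => by simp)
  exact ⟨g, hg ()⟩

/-- The stabiliser of a point acts transitively on the spheres around it. -/
lemma exists_map_sphere (hX : IsUrysohnSpace S X) {t x y : X} (h : dist t x = dist t y) :
    ∃ g : X ≃ᵢ X, g t = t ∧ g x = y := by
  obtain ⟨g, hg⟩ := hX.exists_isometryEquiv (p := fun b : Bool => cond b t x)
    (q := fun b => cond b t y) (by
      rintro (_ | _) (_ | _)
      · simp
      · simpa [dist_comm] using h
      · simpa using h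
      · simp)
  exact ⟨g, hg true, hg false⟩

/-- Triangles with sides in `S ∪ {0}` can be completed. -/
lemma exists_triangle (hX : IsUrysohnSpace S X) (x y : X) {a b : ℝ} (ha : a = 0 ∨ a ∈ S)
    (hb : b = 0 ∨ b ∈ S) (ha0 : 0 ≤ a) (hb0 : 0 ≤ b) (h1 : dist x y ≤ a + b)
    (h2 : a ≤ dist x y + b) (h3 : b ≤ dist x y + a) :
    ∃ z, dist x z = a ∧ dist z y = b := by
  have hxy : x = y ∨ dist x y ∈ S := by simpa using hX.dist_eq_zero_or_mem x y
  have h0 : 0 ≤ dist x y := dist_nonneg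
  obtain ⟨f, hf, hfe⟩ := hX.exists_realization_extending
    (d := ![![0, dist x y, a], ![dist x y, 0, b], ![a, b, 0]])
    (by intro i; fin_cases i <;> simp)
    (by intro i j; fin_cases i <;> fin_cases j <;> simp)
    (by intro i j k; fin_cases i <;> fin_cases j <;> fin_cases k <;> simp <;> linarith)
    (by intro i j; fin_cases i <;> fin_cases j <;> simp [ha, hb, hxy])
    ![(0 : Fin 3), 1] ![x, y]
    (by intro i j; fin_cases i <;> fin_cases j <;> simp [dist_comm])
  have e0 : f 0 = x := hfe 0
  have e1 : f 1 = y := hfe 1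
  refine ⟨f 2, ?_, ?_⟩
  · rw [← e0, hf]
    rfl
  · rw [← e1, hf]
    rfl

end IsUrysohnSpace

namespace IsUrysohnSpace

variable {S : AddSubsemigroup ℝ}

/-- Finite sets `A` and `B` have a free amalgam over a common point `t`: a copy of `A` can be placed
such that all distances to `B` are realised through `t`. -/
lemma exists_independent (hX : IsUrysohnSpace (S : Set ℝ) X) {A B : Finset X} {t : X} (htA : t ∈ A)
    (htB : t ∈ B) :
    ∃ h : X ≃ᵢ X, h t = t ∧ ∀ a ∈ A, ∀ b ∈ B, dist (h a) b = dist a t + dist t b := by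
  let d : A ⊕ B → A ⊕ B → ℝ := fun i j => match i, j with
    | .inl a, .inl a' => dist (a : X) a'
    | .inl a, .inr b => dist (a : X) t + dist t b
    | .inr b, .inl a => dist (a : X) t + dist t b
    | .inr b, .inr b' => dist (b : X) b'
  have hadd : ∀ x y : X, dist x t + dist t y = 0 ∨ dist x t + dist t y ∈ (S : Set ℝ) := by
    intro x y
    rcases hX.dist_eq_zero_or_mem x t with h1 | h1
    · rw [h1, zero_add]
      exact hX.dist_eq_zero_or_mem t y
    · rcases hX.dist_eq_zero_or_mem t y with h2 | h2
      · rw [h2, add_zero]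
        exact Or.inr h1
      · exact Or.inr (S.add_mem h1 h2)
  obtain ⟨f, hf, hfB⟩ := hX.exists_realization_extending (d := d)
    (by rintro (a | b) <;> simp [d])
    (by rintro (a | b) (a' | b') <;> simp [d, dist_comm])
    (by
      rintro (a | a) (b | b) (c | c)
      · exact dist_triangle _ _ _
      · have := dist_triangle (a : X) b t
        simp only [d]
        linarith
      · have h1 := dist_triangle (a : X) t c
        have h2 : 0 ≤ dist t (b : X) := dist_nonneg
        have h3 := dist_comm (c : X) t
        simp only [d]
        linarith
      · have := dist_triangle t (b : X) c
        simp only [d]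
        linarith
      · have h1 := dist_triangle (c : X) b t
        have h2 := dist_comm (c : X) b
        simp only [d]
        linarith
      · have h1 := dist_triangle (a : X) t c
        have h2 : 0 ≤ dist (b : X) t := dist_nonneg
        have h3 := dist_comm (a : X) t
        simp only [d]
        linarith
      · have h1 := dist_triangle t (b : X) a
        have h2 := dist_comm (a : X) b
        simp only [d]
        linarith
      · exact dist_triangle _ _ _)
    (by
      rintro (a | b) (a' | b')
      · exact hX.dist_eq_zero_or_mem _ _
      · exact hadd _ _
      · exact hadd _ _
      · exact hX.dist_eq_zero_or_mem _ _)
    Sum.inr (fun b : B => (b : X)) (fun _ _ => rfl)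
  obtain ⟨h, hh⟩ := hX.exists_isometryEquiv (p := fun a : A => (a : X))
    (q := fun a => f (Sum.inl a)) (fun a a' => (hf (Sum.inl a) (Sum.inl a')).symm)
  have key : ∀ a (ha : a ∈ A) b (hb : b ∈ B), dist (h a) b = dist a t + dist t b := by
    intro a ha b hb
    exact (congrArg₂ dist (hh ⟨a, ha⟩) (hfB ⟨b, hb⟩).symm).trans (hf _ _)
  refine ⟨h, dist_eq_zero.1 ?_, key⟩
  rw [key t htA t htB, dist_self, add_zero]

lemma exists_bddOn_stabilizer (hX : IsUrysohnSpace (S : Set ℝ) X) {L : (X ≃ᵢ X) → ℝ}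
    (hL : IsLength (isomHom X) L) (t : X) : ∃ D, ∀ g : X ≃ᵢ X, g t = t → L g ≤ D := by
  classical
  obtain ⟨A₀, hA₀⟩ := hL.small
  refine hL.bddOn_stabilizer (A := insert t A₀)
    (fun g hg => hA₀ g fun x hx => hg x (Finset.mem_insert_of_mem hx))
    (P := fun h => ∀ a ∈ insert t A₀, ∀ b ∈ insert t A₀, dist (h a) b = dist a t + dist t b)
    (fun g hg => ?_) (fun f h hf hh => ?_)
  · obtain ⟨h, -, h2⟩ := hX.exists_independent (A := insert t A₀)
      (B := insert t A₀ ∪ (insert t A₀).image g) (Finset.mem_insert_self t A₀)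
      (Finset.mem_union_left _ (Finset.mem_insert_self t A₀))
    refine ⟨h, fun a ha b hb => h2 a ha b (Finset.mem_union_left _ hb), fun a ha b hb => ?_⟩
    have h3 := h2 a ha (g b) (Finset.mem_union_right _ (Finset.mem_image_of_mem _ hb))
    have hg' : g t = t := hg
    have h4 := g.dist_eq t b
    rw [hg'] at h4
    rw [← g.dist_eq, IsometryEquiv.mul_apply, IsometryEquiv.apply_inv_self, h3, h4]
  · let κ := {a // a ∈ insert t A₀}
    obtain ⟨v, hv⟩ := hX.exists_isometryEquiv (κ := κ ⊕ κ)
      (p := Sum.elim (fun a => (a : X)) (fun a => f a))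
      (q := Sum.elim (fun a => (a : X)) (fun a => h a)) (by
        rintro (a | a) (b | b)
        · rfl
        · change dist (a : X) (f b) = dist (a : X) (h b)
          rw [dist_comm, hf b b.2 a a.2, dist_comm (a : X), hh b b.2 a a.2]
        · change dist (f a) (b : X) = dist (h a) (b : X)
          rw [hf a a.2 b b.2, hh a a.2 b b.2]
        · change dist (f a) (f b) = dist (h a) (h b)
          rw [f.dist_eq, h.dist_eq])
    exact ⟨v, fun a ha => hv (Sum.inl ⟨a, ha⟩), fun a ha => hv (Sum.inr ⟨a, ha⟩)⟩

lemma nat_mul_eq_zero_or_mem {s : ℝ} (hs : s ∈ S) (n : ℕ) :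
    (n : ℝ) * s = 0 ∨ (n : ℝ) * s ∈ (S : Set ℝ) := by
  induction n with
  | zero => simp
  | succ n ih =>
    right
    push_cast
    rw [add_mul, one_mul]
    rcases ih with h | h
    · rwa [h, zero_add]
    · exact S.add_mem h hs

/-- Displacements that are multiples of a fixed `s ∈ S` are reached in steps of size `s`; arbitrary
displacements are reached in two moves whose sizes are multiples of `s`. -/
theorem orbitControlsLengths (hX : IsUrysohnSpace (S : Set ℝ) X) (hS : ∀ s ∈ S, 0 < s) (t : X) :
    OrbitControlsLengths (isomHom X) (fun x y : X => dist x y) t := by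
  intro L hL
  obtain ⟨D, hD⟩ := hX.exists_bddOn_stabilizer hL t
  have hD0 : 0 ≤ D := hL.one ▸ hD 1 rfl
  by_cases hne : ∃ s, s ∈ S
  swap
  · -- the space is a single point
    refine ⟨D, fun g => ?_⟩
    have h0 : dist t (g t) = 0 := (hX.dist_eq_zero_or_mem _ _).resolve_right fun h => hne ⟨_, h⟩
    have h1 := hD g (dist_eq_zero.1 h0).symm
    change L g ≤ D * dist t (g t) + D
    rw [h0]
    linarith
  obtain ⟨s, hs⟩ := hne
  have hs0 := hS s hs
  obtain ⟨y, hy, -⟩ := hX.exists_triangle t t (Or.inr hs) (Or.inr hs) hs0.le hs0.le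
    (by rw [dist_self]; linarith) (by simp) (by simp)
  obtain ⟨u, rfl⟩ := hX.exists_map_eq t y
  have hu0 := hL.nonneg u
  have key : ∀ n : ℕ, ∀ g : X ≃ᵢ X, dist t (g t) = n * s → L g ≤ n * (D + L u) + D := by
    intro n
    induction n with
    | zero =>
      intro g hg
      rw [Nat.cast_zero, zero_mul, dist_eq_zero] at hg
      simpa using hD g hg.symm
    | succ n ih =>
      intro g hg
      push_cast at hg ⊢
      have hns : 0 ≤ (n : ℝ) * s := by positivity
      obtain ⟨z, hz, hzg⟩ := hX.exists_triangle t (g t) (Or.inr hs) (nat_mul_eq_zero_or_mem hs n)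
        hs0.le hns (by linarith) (by linarith) (by linarith)
      obtain ⟨k, hkt, hkz⟩ := hX.exists_map_sphere (hy.trans hz.symm)
      have h3 := ih ((k * u)⁻¹ * g) (by
        rw [← (k * u).dist_eq, IsometryEquiv.mul_apply _ g, IsometryEquiv.apply_inv_self,
          IsometryEquiv.mul_apply, hkz, hzg])
      have h4 := hL.mul_le (k * u) ((k * u)⁻¹ * g)
      rw [mul_inv_cancel_left] at h4
      have h5 := hL.mul_le k u
      have h6 := hD k hkt
      linarith
  refine ⟨2 * (D + L u) / s + 2 * (D + L u) + 2 * D, fun g => ?_⟩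
  change L g ≤ _ * dist t (g t) + _
  obtain ⟨n, hn1, hn2⟩ : ∃ n : ℕ, dist t (g t) / s ≤ n ∧ (n : ℝ) ≤ dist t (g t) / s + 1 :=
    ⟨⌈dist t (g t) / s⌉₊, Nat.le_ceil _, (Nat.ceil_lt_add_one (by positivity)).le⟩
  have hg0 : 0 ≤ dist t (g t) := dist_nonneg
  rw [div_le_iff₀ hs0] at hn1
  have hn0 : 0 ≤ (n : ℝ) * s := by positivity
  obtain ⟨z, hz, hzg⟩ := hX.exists_triangle t (g t) (nat_mul_eq_zero_or_mem hs n)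
    (nat_mul_eq_zero_or_mem hs n) hn0 hn0 (by linarith) (by linarith) (by linarith)
  obtain ⟨w, rfl⟩ := hX.exists_map_eq t z
  have h1 := key n w hz
  have h2 := key n (w⁻¹ * g) (by
    rw [← w.dist_eq, IsometryEquiv.mul_apply, IsometryEquiv.apply_inv_self, hzg])
  have h3 := hL.mul_le w (w⁻¹ * g)
  rw [mul_inv_cancel_left] at h3
  have h4 : (n : ℝ) * (D + L u) ≤ (dist t (g t) / s + 1) * (D + L u) :=
    mul_le_mul_of_nonneg_right hn2 (by positivity)
  have h5 : 0 ≤ (2 * (D + L u) + 2 * D) * dist t (g t) := by positivity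
  have h6 : 0 ≤ 2 * (D + L u) / s := by positivity
  have h7 : 2 * (D + L u) / s * dist t (g t) = 2 * (dist t (g t) / s * (D + L u)) := by ring
  linarith

lemma isGroupQuasiIsometry (hX : IsUrysohnSpace (S : Set ℝ) X) (hS : ∀ s ∈ S, 0 < s) (t : X) :
    IsGroupQuasiIsometry (permTopology (X ≃ᵢ X) X) (fun x y : X => dist x y)
      (fun g : X ≃ᵢ X => g t) :=
  have := hX.countable
  (hX.orbitControlsLengths hS t).isGroupQuasiIsometry isomHom_injective isPermTopology_isomHom
    isInvariantDist_isomHom (hX.exists_map_eq t)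

end IsUrysohnSpace

end Urysohn

end LargeScale

theorem mainTheorem9 :
    -- the tree `T`, its automorphism group, and the stabiliser of an end
    (∀ (V : Type*) (T : SimpleGraph V), LargeScale.IsAlephZeroRegularTree T →
      (∀ t : V,
        LargeScale.IsGroupQuasiIsometry (LargeScale.permTopology (T ≃g T) V)
          (LargeScale.graphDist T) (fun g : T ≃g T => g t)) ∧
      ∀ e : LargeScale.TreeEnd T,
        (∀ t : V,
          LargeScale.IsGroupQuasiIsometry (LargeScale.endStabilizerTopology T e)
            (LargeScale.graphDist T)
            (fun g : LargeScale.endStabilizer T e => (g : T ≃g T) t)) ∧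
        ∀ m : MetricSpace (T ≃g T),
          LargeScale.IsMaximalMetric (LargeScale.permTopology (T ≃g T) V) m →
          ∃ F : LargeScale.endStabilizer T e → (T ≃g T),
            LargeScale.IsGroupQuasiIsometry (LargeScale.endStabilizerTopology T e) m.dist F) ∧
    -- the Urysohn space with distances in `S` and its isometry group
    (∀ (S : AddSubsemigroup ℝ), (S : Set ℝ).Countable → (∀ s ∈ S, 0 < s) →
      ∀ (X : Type*) [MetricSpace X], LargeScale.IsUrysohnSpace (S : Set ℝ) X →
        ∀ x₀ : X,
          LargeScale.IsGroupQuasiIsometry (LargeScale.permTopology (X ≃ᵢ X) X)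
            (fun x y : X => dist x y) (fun g : X ≃ᵢ X => g x₀)) := by
  -- for the last claim about `T`, the quasi-isometry is the inclusion of the stabiliser
  exact ⟨fun V T hT => ⟨hT.isGroupQuasiIsometry_aut, fun e =>
    ⟨hT.isGroupQuasiIsometry_endStabilizer e, fun m hm =>
      ⟨_, hT.isGroupQuasiIsometry_inclusion e hm⟩⟩⟩, fun S _ hS X _ hX =>
    hX.isGroupQuasiIsometry hS⟩
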